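/- Fix $d\ge 1$ and $\mathbf q=(q_1,\dots,q_d)\in\mathbb Z^d$ with all $q_i>1$, and put $Q=q_1\cdots q_d$. All operations and inequalities on $\mathbb Z^d$ are coordinatewise, and $[\mathbf 0,\mathbf a)=\{\mathbf j\in\mathbb Z^d: 0\le j_i<a_i\}$; for $\mathbf k\in\mathbb Z^d$ let $\lfloor\mathbf k\rfloor_n\in\mathbb Z^d$ be its coordinatewise quotient modulo $\mathbf q^n$, so that $\mathbf k-\lfloor\mathbf k\rfloor_n\mathbf q^n\in[\mathbf 0,\mathbf q^n)$. A $\mathbf q$-substitution $\mathcal S$ on a finite alphabet $\mathcal A$ replaces each letter by a block with domain $[\mathbf 0,\mathbf q)$; it acts on blocks and sequences by $(\mathcal S\omega)(\mathbf b+\mathbf a\mathbf q)=\mathcal S(\omega(\mathbf a))(\mathbf b)$ for $\mathbf b\in[\mathbf 0,\mathbf q)$. For $n\ge 0$ and $\mathbf j\in\mathbb Z^d$ the generalized instruction $\mathcal R^{(n)}_{\mathbf j}:\mathcal A\to\mathcal A$ sends $\gamma$ to the letter of $\mathcal S^n(\gamma)$ at the remainder of $\mathbf j$ modulo $\mathbf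 q^n$; write $\mathcal R^{(n)}_{\mathbf j}$ also for the $0$-$1$ matrix whose $(\alpha,\gamma)$ entry is $1$ if and only if $\alpha=\mathcal R^{(n)}_{\mathbf j}(\gamma)$. The subshift $X_{\mathcal S}\subset\mathcal A^{\mathbb Z^d}$ is the set of sequences all of whose finite subblocks (on arbitrary finite domains) occur, up to translation, in some $\mathcal S^n(\gamma)$, with the shift $(T^{\mathbf k}\mathbf A)(\mathbf j)=\mathbf A(\mathbf j+\mathbf k)$. $\mathcal S$ is aperiodic if $T^{\mathbf k}\mathbf A=\mathbf A$ with $\mathbf A\in X_{\mathcal S}$ implies $\mathbf k=\mathbf 0$. Its index of imprimitivity is the least $h>0$ such that $\lambda^h=Q^h$ for every eigenvalue $\lambda$ of modulus $Q$ of the substitution matrix $M_{\mathcal S}=\sum_{\mathbf j\in[\mathbf 0,\mathbf q)}\mathcal R^{(1)}_{\mathbf j}$. Let $\mu$ be a $T$-invariant Borel probability measure on $X_{\mathcal S}$. The spectral measure of $f,g\in L^2(\mu)$ is the complex Borel measure $\sigma_{f,g}$ on $\mathbb T^d$ with $\widehat{\sigma_{f,g}}(\mathbf k)=\int_{\mathbb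 T^d} z_1^{-k_1}\cdots z_d^{-k_d}\,d\sigma_{f,g}=\int f\circ T^{-\mathbf k}\,\overline g\,d\mu$ for all $\mathbf k\in\mathbb Z^d$. For $\alpha,\beta\in\mathcal A$ the correlation measure $\sigma_{\alpha\beta}$ is the spectral measure of the indicator functions of $[\alpha]=\{\mathbf A\in X_{\mathcal S}:\mathbf A(\mathbf 0)=\alpha\}$ and $[\beta]$. Let $\widehat\Sigma(\mathbf k)=(\widehat{\sigma_{\alpha\beta}}(\mathbf k))_{\alpha\beta\in\mathcal A^2}\in\mathbb C^{\mathcal A^2}$. **Theorem (Fourier recursion).** Let $\mathcal S$ be an aperiodic $\mathbf q$-substitution on $\mathcal A$ with index of imprimitivity $1$, and let $\mu$ be a $T$-invariant Borel probability measure on $X_{\mathcal S}$. Then the correlation measures $\sigma_{\alpha\beta}$ exist, and for all $p\in\mathbb N=\{0,1,2,\dots\}$ and $\mathbf k\in\mathbb Z^d$ $$\widehat\Sigma(\mathbf k)=\frac1{Q^p}\sum_{\mathbf j\in[\mathbf 0,\mathbf q^p)}\bigl(\mathcal R^{(p)}_{\mathbf j}\otimes\mathcal R^{(p)}_{\mathbf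 j+\mathbf k}\bigr)\,\widehat\Sigma\bigl(\lfloor\mathbf j+\mathbf k\rfloor_p\bigr)=\lim_{n\to\infty}\frac1{Q^n}\sum_{\mathbf j\in[\mathbf 0,\mathbf q^n)}\bigl(\mathcal R^{(n)}_{\mathbf j}\otimes\mathcal R^{(n)}_{\mathbf j+\mathbf k}\bigr)\,\widehat\Sigma(\mathbf 0),$$ where $\otimes$ is the Kronecker product, $(A\otimes B)_{\alpha\beta,\gamma\delta}=A_{\alpha\gamma}B_{\beta\delta}$. -/

import Mathlib

open MeasureTheory Filter Topology
open scoped Kronecker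

/-! Arithmetic in `ℤ^d`: all operations and relations are coordinatewise. -/

/-- The half-open box `[0, a) ⊆ ℤ^d`. -/
noncomputable def latticeBox {d : ℕ} (a : Fin d → ℤ) : Finset (Fin d → ℤ) :=
  Fintype.piFinset fun i => Finset.Ico 0 (a i)

/-- The coordinatewise quotient of `k` modulo `a` (Euclidean division). -/
def latticeQuot {d : ℕ} (a k : Fin d → ℤ) : Fin d → ℤ := fun i => k i / a i

/-- The coordinatewise remainder of `k` modulo `a` (Euclidean division). -/
def latticeRem {d : ℕ} (a k : Fin d → ℤ) : Fin d → ℤ := fun i => k i % a i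

theorem latticeRem_mem {d : ℕ} {a : Fin d → ℤ} (ha : ∀ i, 0 < a i) (k : Fin d → ℤ) :
    latticeRem a k ∈ latticeBox a := by
  simp only [latticeBox, latticeRem, Fintype.mem_piFinset, Finset.mem_Ico]
  exact fun i => ⟨Int.emod_nonneg _ (ha i).ne', Int.emod_lt_of_pos _ (ha i)⟩

/-- A partially defined `A`-valued sequence on `ℤ^d`; it is undefined at `j` when its value there
is `none`. -/
abbrev PartialSeq (d : ℕ) (A : Type*) := (Fin d → ℤ) → Option A

namespace PartialSeq

variable {d : ℕ} {A : Type*}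

/-- The shift `(T^k ω)(j) = ω(j + k)`. -/
def shift (k : Fin d → ℤ) (ω : PartialSeq d A) : PartialSeq d A := fun j => ω (j + k)

/-- `η` extends `ω`. -/
def ExtendedBy (ω η : PartialSeq d A) : Prop := ∀ j a, ω j = some a → η j = some a

/-- A block is a partial sequence with finite domain. -/
def IsBlock (ω : PartialSeq d A) : Prop := {j | ω j ≠ none}.Finite

/-- `ω` is a subblock of `η`: some translate of `ω` is extended by `η`. -/
def IsSubblock (ω η : PartialSeq d A) : Prop := ∃ k, ExtendedBy (shift k ω) η

/-- The one-letter block `0 ↦ γ`. -/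
def letter (γ : A) : PartialSeq d A := fun j => if j = 0 then some γ else none

/-- A sequence defined on all of `ℤ^d`. -/
def ofSeq (a : (Fin d → ℤ) → A) : PartialSeq d A := fun j => some (a j)

end PartialSeq

/-- A substitution on the alphabet `A` that replaces every letter by a block with domain `[0, q)`,
where every coordinate of the expansion `q` is greater than `1`. -/
structure QSubstitution (d : ℕ) (A : Type*) where
  q : Fin d → ℤ
  one_lt_q : ∀ i, 1 < q i
  word : A → latticeBox q → A

namespace QSubstitution

variable {d : ℕ} {A : Type*} (S : QSubstitution d A)

theorem q_pos (i : Fin d) : 0 < S.q i := lt_trans zero_lt_one (S.one_lt_q i)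

/-- `Q = q_1 ⋯ q_d`, the cardinality of `[0, q)`. -/
def Q : ℤ := ∏ i, S.q i

/-- The `j`-th instruction `γ ↦ (Sγ)(j)` for `j ∈ [0, q)`, extended to `j ∈ ℤ^d` by reduction
modulo `q`. -/
noncomputable def instruction (j : Fin d → ℤ) (γ : A) : A :=
  S.word γ ⟨latticeRem S.q j, latticeRem_mem S.q_pos j⟩

/-- The action of the substitution on partial sequences by inflation and subdivision: the letter
at `a` is replaced by its block, placed on `a q + [0, q)`. -/
noncomputable def act (ω : PartialSeq d A) : PartialSeq d A :=
  fun j => (ω (latticeQuot S.q j)).map (S.instruction j)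

/-- The generalized instruction `R_j^{(n)} = R_{j_0} ∘ ⋯ ∘ R_{j_{n-1}}`, where `j_0, j_1, …` are
the `q`-adic digits of `j`. For `j ∈ [0, q^n)` it is the `j`-th instruction of `S^n`, and it depends
on `j` only modulo `q^n`; see `act_iterate_letter` and `genInstruction_latticeRem`. -/
noncomputable def genInstruction : ℕ → (Fin d → ℤ) → A → A
  | 0, _ => id
  | n + 1, j => S.instruction j ∘ genInstruction n (latticeQuot S.q j)

theorem act_iterate_letter (n : ℕ) (γ : A) (j : Fin d → ℤ) :
    S.act^[n] (PartialSeq.letter γ) j =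
      if j ∈ latticeBox (S.q ^ n) then some (S.genInstruction n j γ) else none := by
  induction n generalizing j with
  | zero =>
    have h : j ∈ latticeBox (S.q ^ 0) ↔ j = 0 := by
      simp only [latticeBox, Fintype.mem_piFinset, Finset.mem_Ico, pow_zero, Pi.one_apply,
        funext_iff, Pi.zero_apply]
      exact forall_congr' fun i => by omega
    simp only [Function.iterate_zero, id_eq, PartialSeq.letter, h, genInstruction]
  | succ n ih =>
    have h : latticeQuot S.q j ∈ latticeBox (S.q ^ n) ↔ j ∈ latticeBox (S.q ^ (n + 1)) := by
      simp only [latticeBox, latticeQuot, Fintype.mem_piFinset, Finset.mem_Ico, Pi.pow_apply]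
      refine forall_congr' fun i => ?_
      rw [Int.ediv_lt_iff_lt_mul (S.q_pos i), pow_succ, Int.ediv_nonneg_iff_of_pos (S.q_pos i)]
    rw [Function.iterate_succ_apply']
    simp only [act, ih, h, genInstruction]
    split_ifs <;> simp

theorem genInstruction_latticeRem (n : ℕ) (j : Fin d → ℤ) :
    S.genInstruction n (latticeRem (S.q ^ n) j) = S.genInstruction n j := by
  induction n generalizing j with
  | zero => rfl
  | succ n ih =>
    have h1 : latticeRem S.q (latticeRem (S.q ^ (n + 1)) j) = latticeRem S.q j := by
      funext i
      simp only [latticeRem, Pi.pow_apply]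
      exact Int.emod_emod_of_dvd _ (dvd_pow_self _ n.succ_ne_zero)
    have h2 : latticeQuot S.q (latticeRem (S.q ^ (n + 1)) j) =
        latticeRem (S.q ^ n) (latticeQuot S.q j) := by
      funext i
      simp only [latticeRem, latticeQuot, Pi.pow_apply]
      have hq := S.q_pos i
      rw [Int.emod_def, pow_succ', Int.emod_def, Int.ediv_ediv_of_nonneg hq.le, mul_assoc,
        Int.sub_mul_ediv_left _ _ hq.ne']
    have h3 : S.instruction (latticeRem (S.q ^ (n + 1)) j) = S.instruction j := by
      funext γ
      simp only [instruction, h1]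
    simp only [genInstruction, h2, h3, ih]

/-- The language: all blocks that are subblocks of some `S^n(γ)`. -/
def language : Set (PartialSeq d A) :=
  {ω | ω.IsBlock ∧ ∃ (n : ℕ) (γ : A), ω.IsSubblock (S.act^[n] (PartialSeq.letter γ))}

/-- The substitution subshift `X_S`: all sequences all of whose subblocks are in the language. -/
def subshift : Set ((Fin d → ℤ) → A) :=
  {a | ∀ ω : PartialSeq d A, ω.IsBlock → ω.IsSubblock (PartialSeq.ofSeq a) → ω ∈ S.language}

/-- The shift `T^k` on `X_S`. -/
def shift (k : Fin d → ℤ) (a : S.subshift) : S.subshift :=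
  ⟨fun j => a.1 (j + k), by
    rintro ω hω ⟨l, hl⟩
    refine a.2 ω hω ⟨l - k, fun j b hb => ?_⟩
    have := hl (j - k) b (by
      simp only [PartialSeq.shift] at hb ⊢
      rwa [show j - k + l = j + (l - k) by abel])
    simpa [PartialSeq.ofSeq] using this⟩

/-- No element of `X_S` has a nonzero period. -/
def Aperiodic : Prop := ∀ (a : S.subshift) (k : Fin d → ℤ), S.shift k a = a → k = 0

/-- The matrix of the generalized instruction `R_j^{(n)}`: its `(α, γ)` entry is `1` if
`α = R_j^{(n)}(γ)` and `0` otherwise. -/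
noncomputable def instructionMatrix [DecidableEq A] (n : ℕ) (j : Fin d → ℤ) : Matrix A A ℂ :=
  Matrix.of fun α γ => if α = S.genInstruction n j γ then 1 else 0

/-- The substitution matrix: its `(α, γ)` entry is the number of occurrences of `α` in `S(γ)`. -/
noncomputable def substitutionMatrix [DecidableEq A] : Matrix A A ℂ :=
  Matrix.of fun α γ => ((Finset.univ.filter fun j => S.word γ j = α).card : ℂ)

/-- The index of imprimitivity: the least `h > 0` such that `z ^ h = Q ^ h` for every eigenvalue `z`
of modulus `Q` of the substitution matrix. -/
noncomputable def imprimitivityIndex [Fintype A] [DecidableEq A] : ℕ :=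
  sInf {h : ℕ | 0 < h ∧ ∀ z : ℂ,
    Module.End.HasEigenvalue (Matrix.toLin' S.substitutionMatrix) z →
      ‖z‖ = (S.Q : ℝ) → z ^ h = (S.Q : ℂ) ^ h}

variable [MeasurableSpace A]

/-- Invariance of a measure on `X_S` under all shifts `T^k`. For a finite alphabet with the discrete
`σ`-algebra, the `σ`-algebra that `X_S` inherits from the product is its Borel `σ`-algebra. -/
def ShiftInvariant (μ : Measure S.subshift) : Prop :=
  ∀ k : Fin d → ℤ, MeasurePreserving (S.shift k) μ μ

/-- The `k`-th Fourier coefficient `∫ z_1^{-k_1} ⋯ z_d^{-k_d} dσ` of a complex measure on the torus,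
with `z_i = e^{2 π i x_i}` for `x ∈ (ℝ/ℤ)^d`. -/
noncomputable def _root_.torusFourierCoeff (σ : ComplexMeasure (UnitAddTorus (Fin d)))
    (k : Fin d → ℤ) : ℂ :=
  σ.integral (fun x => UnitAddTorus.mFourier (-k) x) (ContinuousLinearMap.mul ℝ ℂ)

/-- `σ` is the spectral measure of the pair `f, g` with respect to `μ`: for every `k`, its `k`-th
Fourier coefficient is `∫ (f ∘ T^{-k}) · conj g dμ`. -/
def IsSpectralMeasure (μ : Measure S.subshift) (f g : S.subshift → ℂ)
    (σ : ComplexMeasure (UnitAddTorus (Fin d))) : Prop :=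
  ∀ k : Fin d → ℤ,
    torusFourierCoeff σ k = ∫ a, f (S.shift (-k) a) * (starRingEnd ℂ) (g a) ∂μ

/-- The spectral measure `σ_{f,g}` of the pair `f, g` (a junk value if there is none). -/
noncomputable def spectralMeasure (μ : Measure S.subshift) (f g : S.subshift → ℂ) :
    ComplexMeasure (UnitAddTorus (Fin d)) :=
  Classical.epsilon (S.IsSpectralMeasure μ f g)

/-- The indicator function of the initial cylinder `[α] = {a ∈ X_S : a(0) = α}`. -/
noncomputable def cylinderIndicator (α : A) : S.subshift → ℂ :=
  Set.indicator {a | a.1 0 = α} 1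

/-- The correlation measure `σ_{αβ}`. -/
noncomputable def correlationMeasure (μ : Measure S.subshift) (α β : A) :
    ComplexMeasure (UnitAddTorus (Fin d)) :=
  S.spectralMeasure μ (S.cylinderIndicator α) (S.cylinderIndicator β)

/-- The `k`-th Fourier coefficient of the correlation vector `Σ = (σ_{αβ})_{αβ ∈ A²}`. -/
noncomputable def correlationVectorCoeff (μ : Measure S.subshift) (k : Fin d → ℤ) :
    A × A → ℂ :=
  fun αβ => torusFourierCoeff (S.correlationMeasure μ αβ.1 αβ.2) k

end QSubstitution

/-! By invariance, the `(α, β)` entry of the `k`-th coefficient is the measure of the set where `a x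
= α` and `a (x + k) = β`, for any `x`, so it can be averaged over a large box of positions `x`.
Every finite part of a point of the subshift sits inside an `n`-fold substituted sequence, that is,
a tiling by words `S^n(γ)`. Inside one tile the pairs at distance `k` are counted by a column of
`P_n(k) = S.pairFreq n k`, apart from the proportion `1 - overlapFrac (S.q ^ n) k` of positions
whose partner leaves the tile. Averaging and integrating, the coefficients at `k` and at `0` lie
within these errors (plus any `ε > 0`) of `P_n(k) w` and `P_n(0) w`, with one probability vector `w`
for both (`ShiftInvariant.exists_stdSimplex_norm_sub_le`).

The vector `w` must be replaced by the letter frequencies `u` of `μ`, and here the index of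
imprimitivity enters. The letter frequency matrices are the powers of `D = M / Q`, which are
bounded; index `1` leaves `1` as the only possible eigenvalue of modulus one, so `D^m (1 - D) → 0`.
Take `w` at level `n + m`. The case `k = 0` gives `D^(n+m) w → u` as `m → ∞`, hence `D^m w → u`.
Since `P_(n+m)(k)` is within the level-`n` boundary error of `P_n(k) D^m`, the coefficient at `k` is
within that error of `P_n(k) u` (`ShiftInvariant.norm_correlationVectorCoeff_sub_le`). The error
vanishes as `n → ∞`, and `P_n(k) u` is the `n`-th term of the limit formula, because the coefficient
vector at `0` is `u` on the diagonal and zero elsewhere.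

The averaging operators form a semigroup in `n` (`correlationOp_add`), so the finite recursion is
the limit formula with `p` levels split off. Existence of the correlation measures is Herglotz's
theorem combined with polarization. -/

/-! ### Powers of power bounded operators. -/

theorem tendsto_zero_of_norm_succ_sub_smul {V : Type*} [NormedAddCommGroup V] [NormedSpace ℂ V]
    {z : ℂ} (hz : ‖z‖ < 1) {s : ℕ → V}
    (h : Tendsto (fun m => s (m + 1) - z • s m) atTop (𝓝 0)) : Tendsto s atTop (𝓝 0) := by
  rw [Metric.tendsto_atTop] at h ⊢
  simp only [dist_zero_right] at h ⊢
  intro ε hε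
  -- With this tolerance `ε / 2` is the fixed point of `t ↦ ε / 2 * (1 - ‖z‖) + ‖z‖ * t`, so only a
  -- geometric term is added to it.
  obtain ⟨N, hN⟩ := h (ε / 2 * (1 - ‖z‖)) (mul_pos (half_pos hε) (sub_pos.2 hz))
  have hb : ∀ j, ‖s (N + j)‖ ≤ ε / 2 + ‖z‖ ^ j * ‖s N‖ := by
    intro j
    induction j with
    | zero => simp; positivity
    | succ j ih =>
      have h1 := (hN (N + j) (by omega)).le
      have h2 : s (N + (j + 1)) = (s (N + j + 1) - z • s (N + j)) + z • s (N + j) := by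
        rw [sub_add_cancel, add_assoc]
      calc ‖s (N + (j + 1))‖ ≤ ε / 2 * (1 - ‖z‖) + ‖z‖ * ‖s (N + j)‖ := by
            rw [h2, ← norm_smul]
            exact (norm_add_le _ _).trans (by gcongr)
        _ ≤ ε / 2 * (1 - ‖z‖) + ‖z‖ * (ε / 2 + ‖z‖ ^ j * ‖s N‖) := by gcongr
        _ = _ := by ring
  have h0 : Tendsto (fun j => ‖z‖ ^ j * ‖s N‖) atTop (𝓝 0) := by
    simpa using (tendsto_pow_atTop_nhds_zero_of_lt_one (norm_nonneg z) hz).mul_const ‖s N‖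
  obtain ⟨J, hJ⟩ := (h0.eventually_lt_const (half_pos hε)).exists_forall_of_atTop
  refine ⟨N + J, fun m hm => ?_⟩
  obtain ⟨j, rfl⟩ := Nat.exists_eq_add_of_le (le_of_add_le_left hm)
  linarith [hb j, hJ j (by omega)]

namespace Module.End

variable {V : Type*} [NormedAddCommGroup V] [NormedSpace ℂ V] {f : Module.End ℂ V}

/-- The difference `f^(m+1) v - z f^m v` is `f^m` applied to a generalized eigenvector of lower
order, so it tends to zero by induction, and the contraction by `z` does the rest. -/
theorem tendsto_pow_apply_zero_of_genEigenvector {z : ℂ} (hz : ‖z‖ < 1) (k : ℕ) {v : V}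
    (hv : ((f - z • 1) ^ k) v = 0) : Tendsto (fun m => (f ^ m) v) atTop (𝓝 0) := by
  induction k generalizing v with
  | zero =>
    have : v = 0 := by simpa using hv
    simp [this]
  | succ k ih =>
    refine tendsto_zero_of_norm_succ_sub_smul hz ?_
    refine (ih (v := (f - z • 1) v) (by simpa [pow_succ] using hv)).congr fun m => ?_
    simp [pow_succ]

/-- A nontrivial Jordan block at `1` makes the orbit grow linearly: by induction `y = (f - 1) v` is
fixed, so `f^m v = v + m y`. -/
theorem apply_eq_self_of_genEigenvector_one (hb : ∀ v, ∃ C, ∀ m, ‖(f ^ m) v‖ ≤ C) (k : ℕ) {v : V}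
    (hv : ((f - 1) ^ k) v = 0) : f v = v := by
  induction k generalizing v with
  | zero =>
    have : v = 0 := by simpa using hv
    simp [this]
  | succ k ih =>
    have hy := ih (v := (f - 1) v) (by simpa [pow_succ] using hv)
    set y := (f - 1) v with hydef
    have hfv : f v = v + y := by simp [hydef]
    have hm : ∀ m : ℕ, (f ^ m) v = v + m • y := by
      intro m
      induction m with
      | zero => simp
      | succ m ihm => rw [pow_succ', Module.End.mul_apply, ihm, map_add, map_nsmul, hy, hfv,
          succ_nsmul']; abel
    obtain ⟨C, hC⟩ := hb v
    have hy0 : y = 0 := by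
      by_contra hne
      have hpos : 0 < ‖y‖ := norm_pos_iff.2 hne
      obtain ⟨m, hm'⟩ := exists_nat_gt ((C + ‖v‖) / ‖y‖)
      rw [div_lt_iff₀ hpos] at hm'
      have h1 := hC m
      rw [hm] at h1
      have h2 : ‖m • y‖ = m * ‖y‖ := by
        rw [← Nat.cast_smul_eq_nsmul ℝ, norm_smul]; simp
      have h3 : ‖m • y‖ ≤ ‖v + m • y‖ + ‖v‖ := by
        simpa using norm_sub_le (v + m • y) v
      linarith
    rw [hfv, hy0, add_zero]

theorem norm_le_one_of_hasEigenvalue (hb : ∀ v, ∃ C, ∀ m, ‖(f ^ m) v‖ ≤ C) {z : ℂ}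
    (hz : f.HasEigenvalue z) : ‖z‖ ≤ 1 := by
  by_contra! hlt
  obtain ⟨v, hv⟩ := hz.exists_hasEigenvector
  obtain ⟨C, hC⟩ := hb v
  have hpos : 0 < ‖v‖ := norm_pos_iff.2 hv.2
  obtain ⟨m, hm⟩ := pow_unbounded_of_one_lt (C / ‖v‖) hlt
  rw [div_lt_iff₀ hpos] at hm
  have := hC m
  rw [hv.pow_apply, norm_smul, norm_pow] at this
  linarith

/-- A power bounded operator whose only unimodular eigenvalue is `1` satisfies
`f ^ m (v - f v) → 0`. -/
theorem tendsto_pow_sub_apply [FiniteDimensional ℂ V] (hb : ∀ v, ∃ C, ∀ m, ‖(f ^ m) v‖ ≤ C)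
    (he : ∀ z, f.HasEigenvalue z → ‖z‖ = 1 → z = 1) (v : V) :
    Tendsto (fun m => (f ^ m) (v - f v)) atTop (𝓝 0) := by
  -- The assertion is linear in `v`, so it suffices to check it on the generalized eigenspaces,
  -- which span.
  let W : Submodule ℂ V :=
    { carrier := {v | Tendsto (fun m => (f ^ m) (v - f v)) atTop (𝓝 0)}
      zero_mem' := by simp
      add_mem' := by
        intro v w hv hw
        have := Tendsto.add hv hw
        rw [add_zero] at this
        refine this.congr fun m => ?_
        simp only [map_sub, map_add]; abel
      smul_mem' := by
        intro c v hv
        have := Tendsto.const_smul hv c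
        rw [smul_zero] at this
        refine this.congr fun m => ?_
        simp only [map_sub, map_smul, smul_sub] }
  suffices h : (⊤ : Submodule ℂ V) ≤ W from h Submodule.mem_top
  rw [← iSup_maxGenEigenspace_eq_top f]
  refine iSup_le fun z v hv => ?_
  rw [mem_maxGenEigenspace] at hv
  obtain ⟨k, hk⟩ := hv
  change Tendsto (fun m => (f ^ m) (v - f v)) atTop (𝓝 0)
  by_cases hz : f.HasEigenvalue z
  · rcases (norm_le_one_of_hasEigenvalue hb hz).lt_or_eq with hlt | heq
    · have h := tendsto_pow_apply_zero_of_genEigenvector hlt k hk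
      have h' := h.sub ((tendsto_add_atTop_iff_nat 1).2 h)
      rw [sub_zero] at h'
      refine h'.congr fun m => ?_
      simp [pow_succ]
    · obtain rfl := he z hz heq
      rw [apply_eq_self_of_genEigenvector_one hb k (by simpa using hk)]
      simp
  · have hinj : Function.Injective (f - z • 1 : Module.End ℂ V) := by
      rw [← LinearMap.ker_eq_bot]
      rw [HasEigenvalue, HasUnifEigenvalue, not_not] at hz
      exact (eigenspace_def (f := f) (μ := z)).symm.trans hz
    have : v = 0 := by
      have hinj' : Function.Injective ((f - z • 1) ^ k : Module.End ℂ V) := by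
        rw [Module.End.coe_pow]; exact hinj.iterate k
      exact hinj' (by rw [hk, map_zero])
    simp [this]

end Module.End

theorem Matrix.tendsto_pow_mul_one_sub {A : Type*} [Fintype A] [DecidableEq A] {D : Matrix A A ℂ}
    {C : ℝ} (hb : ∀ m i j, ‖(D ^ m) i j‖ ≤ C)
    (he : ∀ z, Module.End.HasEigenvalue (Matrix.toLin' D) z → ‖z‖ = 1 → z = 1) :
    Tendsto (fun m => D ^ m * (1 - D)) atTop (𝓝 0) := by
  have hb' : ∀ v, ∃ C, ∀ m, ‖(Matrix.toLin' D ^ m) v‖ ≤ C := by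
    intro v
    refine ⟨∑ j, C * ‖v j‖, fun m => ?_⟩
    have h0 : 0 ≤ ∑ j, C * ‖v j‖ := Finset.sum_nonneg fun j _ =>
      mul_nonneg ((norm_nonneg _).trans (hb 0 j j)) (norm_nonneg _)
    rw [← Matrix.toLin'_pow, Matrix.toLin'_apply, pi_norm_le_iff_of_nonneg h0]
    intro i
    refine (norm_sum_le _ _).trans (Finset.sum_le_sum fun j _ => ?_)
    rw [norm_mul]
    gcongr
    exact hb m i j
  refine tendsto_pi_nhds.2 fun i => tendsto_pi_nhds.2 fun j => ?_
  have h := Module.End.tendsto_pow_sub_apply hb' he (Pi.single j 1)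
  rw [tendsto_pi_nhds] at h
  refine (h i).congr fun m => ?_
  rw [← Matrix.toLin'_pow, Matrix.toLin'_apply, Matrix.toLin'_apply,
    show (Pi.single j 1 : A → ℂ) - D.mulVec (Pi.single j 1) =
      (1 - D).mulVec (Pi.single j 1) by
      rw [Matrix.sub_mulVec, Matrix.one_mulVec],
    Matrix.mulVec_mulVec, Matrix.mulVec_single_one]
  rfl

/-! ### Boxes in the lattice: overlaps, Euclidean division and tilings. -/

section Lattice

variable {d : ℕ}

theorem mem_latticeBox {a x : Fin d → ℤ} : x ∈ latticeBox a ↔ ∀ i, 0 ≤ x i ∧ x i < a i := by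
  simp [latticeBox]

theorem card_latticeBox {a : Fin d → ℤ} (ha : ∀ i, 0 ≤ a i) :
    ((latticeBox a).card : ℤ) = ∏ i, a i := by
  rw [latticeBox, Fintype.card_piFinset]
  push_cast
  exact Finset.prod_congr rfl fun i _ => by simp [ha i]

theorem card_latticeBox_pos {a : Fin d → ℤ} (ha : ∀ i, 0 < a i) : 0 < (latticeBox a).card := by
  have := card_latticeBox fun i => (ha i).le
  have h2 : 0 < ∏ i, a i := Finset.prod_pos fun i _ => ha i
  omega

/-- The proportion of points of the box that stay in the box when translated by `k`. -/
noncomputable def overlapFrac (a k : Fin d → ℤ) : ℝ :=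
  ((latticeBox a).filter fun x => x + k ∈ latticeBox a).card / (latticeBox a).card

theorem overlapFrac_eq_prod (a k : Fin d → ℤ) :
    overlapFrac a k = ∏ i, ((((Finset.Ico 0 (a i)).filter fun t =>
      t + k i ∈ Finset.Ico 0 (a i)).card : ℝ) / (Finset.Ico 0 (a i)).card) := by
  have h : (latticeBox a).filter (fun x => x + k ∈ latticeBox a) =
      Fintype.piFinset fun i => (Finset.Ico 0 (a i)).filter fun t =>
        t + k i ∈ Finset.Ico 0 (a i) := by
    ext x
    simp only [latticeBox, Finset.mem_filter, Fintype.mem_piFinset, Pi.add_apply]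
    exact forall_and.symm
  rw [overlapFrac, h, Fintype.card_piFinset, latticeBox, Fintype.card_piFinset, Finset.prod_div_distrib]
  push_cast
  rfl

theorem tendsto_overlap_one {u : ℕ → ℤ} (hu : Tendsto u atTop atTop) (k : ℤ) :
    Tendsto (fun n => (((Finset.Ico 0 (u n)).filter fun t =>
      t + k ∈ Finset.Ico 0 (u n)).card : ℝ) / (Finset.Ico 0 (u n)).card) atTop (𝓝 1) := by
  have hu' : Tendsto (fun n => (u n : ℝ)) atTop atTop := tendsto_intCast_atTop_atTop.comp hu
  have h0 : Tendsto (fun n => 1 - (|k| : ℝ) / u n) atTop (𝓝 1) := by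
    simpa using (hu'.const_div_atTop (|k| : ℝ)).const_sub 1
  refine tendsto_of_tendsto_of_tendsto_of_le_of_le' h0 tendsto_const_nhds ?_ ?_
  · filter_upwards [hu.eventually_ge_atTop 1] with n hn
    have hpos : (0 : ℝ) < u n := by exact_mod_cast hn
    have hc : ((Finset.Ico 0 (u n)).card : ℝ) = u n := by
      have : ((Finset.Ico 0 (u n)).card : ℤ) = u n := by simp; omega
      exact_mod_cast this
    rw [hc, le_div_iff₀ hpos, sub_mul, one_mul, div_mul_cancel₀ _ hpos.ne']
    -- This interval has at least `u n - |k|` points.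
    have hsub : Finset.Ico (max 0 (-k)) (min (u n) (u n - k)) ⊆
        (Finset.Ico 0 (u n)).filter fun t => t + k ∈ Finset.Ico 0 (u n) := by
      intro t ht
      simp only [Finset.mem_Ico, Finset.mem_filter, max_le_iff, lt_min_iff] at ht ⊢
      omega
    have h1 := Finset.card_le_card hsub
    rw [Int.card_Ico] at h1
    have h2 : u n - |k| ≤ (((Finset.Ico 0 (u n)).filter fun t =>
        t + k ∈ Finset.Ico 0 (u n)).card : ℤ) := by
      rcases abs_cases k with h | h <;> omega
    exact_mod_cast h2
  · filter_upwards with n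
    exact div_le_one_of_le₀ (by exact_mod_cast Finset.card_filter_le _ _) (by positivity)

theorem tendsto_overlapFrac {u : ℕ → Fin d → ℤ} (hu : ∀ i, Tendsto (fun n => u n i) atTop atTop)
    (k : Fin d → ℤ) : Tendsto (fun n => overlapFrac (u n) k) atTop (𝓝 1) := by
  simp_rw [overlapFrac_eq_prod]
  simpa using tendsto_finsetProd Finset.univ fun i _ => tendsto_overlap_one (hu i) (k i)

theorem card_filter_notMem_latticeBox {a : Fin d → ℤ} (ha : ∀ i, 0 < a i) (k : Fin d → ℤ) :
    (((latticeBox a).filter fun x => x + k ∉ latticeBox a).card : ℝ) =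
      (1 - overlapFrac a k) * (latticeBox a).card := by
  have h := Finset.card_filter_add_card_filter_not (s := latticeBox a)
    (fun x => x + k ∈ latticeBox a)
  have hpos : (0 : ℝ) < (latticeBox a).card := by exact_mod_cast card_latticeBox_pos ha
  rw [sub_mul, one_mul, overlapFrac, div_mul_cancel₀ _ hpos.ne', eq_sub_iff_add_eq']
  exact_mod_cast h

theorem latticeQuot_add_mul {a : Fin d → ℤ} (ha : ∀ i, 0 < a i) (x l : Fin d → ℤ) :
    latticeQuot a (x + a * l) = latticeQuot a x + l := by
  funext i
  simp [latticeQuot, Int.add_mul_ediv_left _ _ (ha i).ne']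

theorem latticeRem_add_mul (a x l : Fin d → ℤ) :
    latticeRem a (x + a * l) = latticeRem a x := by
  funext i
  simp [latticeRem]

theorem latticeQuot_of_mem {a x : Fin d → ℤ} (hx : x ∈ latticeBox a) : latticeQuot a x = 0 := by
  funext i
  have := mem_latticeBox.1 hx i
  exact Int.ediv_eq_zero_of_lt this.1 this.2

theorem latticeRem_of_mem {a x : Fin d → ℤ} (hx : x ∈ latticeBox a) : latticeRem a x = x := by
  funext i
  have := mem_latticeBox.1 hx i
  exact Int.emod_eq_of_lt this.1 this.2

theorem latticeRem_add_mul_latticeQuot (a x : Fin d → ℤ) :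
    latticeRem a x + a * latticeQuot a x = x := by
  funext i
  exact Int.emod_add_mul_ediv (x i) (a i)

theorem latticeQuot_mul {a : Fin d → ℤ} (ha : ∀ i, 0 < a i) (b x : Fin d → ℤ) :
    latticeQuot (a * b) x = latticeQuot b (latticeQuot a x) := by
  funext i
  simp [latticeQuot, Int.ediv_ediv_of_nonneg (ha i).le]

theorem latticeQuot_mem_iff {a : Fin d → ℤ} (ha : ∀ i, 0 < a i) (b x : Fin d → ℤ) :
    latticeQuot a x ∈ latticeBox b ↔ x ∈ latticeBox (a * b) := by
  simp only [mem_latticeBox, latticeQuot, Pi.mul_apply]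
  refine forall_congr' fun i => ?_
  rw [Int.ediv_lt_iff_lt_mul (ha i), Int.ediv_nonneg_iff_of_pos (ha i), mul_comm]

/-- Euclidean division by `a` is a bijection between the large box and pairs of remainder and
quotient. -/
theorem sum_latticeBox_mul {M : Type*} [AddCommMonoid M] {a : Fin d → ℤ} (ha : ∀ i, 0 < a i)
    (b : Fin d → ℤ) (f : (Fin d → ℤ) → M) :
    ∑ j ∈ latticeBox (a * b), f j =
      ∑ i ∈ latticeBox a, ∑ l ∈ latticeBox b, f (i + a * l) := by
  rw [← Finset.sum_product']
  refine Finset.sum_nbij' (fun j => (latticeRem a j, latticeQuot a j)) (fun p => p.1 + a * p.2)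
    ?_ ?_ ?_ ?_ ?_
  · intro j hj
    rw [Finset.mem_product]
    exact ⟨latticeRem_mem ha j, (latticeQuot_mem_iff ha b j).2 hj⟩
  · rintro ⟨i, l⟩ h
    rw [Finset.mem_product] at h
    rw [← latticeQuot_mem_iff ha, latticeQuot_add_mul ha, latticeQuot_of_mem h.1, zero_add]
    exact h.2
  · intro j _
    exact latticeRem_add_mul_latticeQuot a j
  · rintro ⟨i, l⟩ h
    rw [Finset.mem_product] at h
    simp only [latticeRem_add_mul, latticeQuot_add_mul ha, latticeQuot_of_mem h.1,
      latticeRem_of_mem h.1, zero_add]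
  · intro j _
    simp only [latticeRem_add_mul_latticeQuot]

/-- If the sums of `φ` over the translated tiles contained in `F` are small, then so is the sum
of `φ` over `F`, up to the points of `F` whose tile is not contained in `F`. -/
theorem norm_sum_le_of_tiles {a : Fin d → ℤ} (ha : ∀ i, 0 < a i) (F : Finset (Fin d → ℤ))
    (t : Fin d → ℤ) {φ : (Fin d → ℤ) → ℂ} {β : ℝ} (hβ : 0 ≤ β) (hφ : ∀ x, ‖φ x‖ ≤ 2)
    (hl : ∀ l, ‖∑ i ∈ latticeBox a, φ (i + a * l - t)‖ ≤ β * (latticeBox a).card) :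
    ‖∑ x ∈ F, φ x‖ ≤ β * F.card +
      2 * (F.filter fun x => ¬ ∀ i ∈ latticeBox a, i + a * latticeQuot a (x + t) - t ∈ F).card := by
  set U := F.filter fun x => ∀ i ∈ latticeBox a, i + a * latticeQuot a (x + t) - t ∈ F with hU
  -- `U` is a disjoint union of whole tiles. The target monoid is left general so that the same
  -- reindexing both counts `U` and sums `φ`.
  have hfib : ∀ l ∈ U.image (fun x => latticeQuot a (x + t)), ∀ {M : Type} [AddCommMonoid M]
      (g : (Fin d → ℤ) → M), ∑ x ∈ U.filter (fun x => latticeQuot a (x + t) = l), g x =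
        ∑ i ∈ latticeBox a, g (i + a * l - t) := by
    intro l hl M _ g
    obtain ⟨y, hy, rfl⟩ := Finset.mem_image.1 hl
    rw [hU, Finset.mem_filter] at hy
    refine Finset.sum_nbij' (fun x => latticeRem a (x + t))
      (fun i => i + a * latticeQuot a (y + t) - t) ?_ ?_ ?_ ?_ ?_
    · intro x _
      exact latticeRem_mem ha _
    · intro i hi
      rw [Finset.mem_filter, hU, Finset.mem_filter]
      simp only [sub_add_cancel, latticeQuot_add_mul ha, latticeQuot_of_mem hi, zero_add]
      exact ⟨⟨hy.2 i hi, hy.2⟩, trivial⟩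
    · intro x hx
      rw [← (Finset.mem_filter.1 hx).2]
      simp only [latticeRem_add_mul_latticeQuot, add_sub_cancel_right]
    · intro i hi
      simp only [sub_add_cancel, latticeRem_add_mul, latticeRem_of_mem hi]
    · intro x hx
      rw [← (Finset.mem_filter.1 hx).2]
      simp only [latticeRem_add_mul_latticeQuot, add_sub_cancel_right]
  have hmaps : ∀ x ∈ U, latticeQuot a (x + t) ∈ U.image (fun x => latticeQuot a (x + t)) :=
    fun x hx => Finset.mem_image_of_mem _ hx
  have hcard : U.card = (U.image fun x => latticeQuot a (x + t)).card * (latticeBox a).card := by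
    rw [Finset.card_eq_sum_ones, ← Finset.sum_fiberwise_of_maps_to hmaps,
      Finset.sum_congr rfl fun l hl => hfib l hl _]
    simp
  have h1 : ‖∑ x ∈ U, φ x‖ ≤ β * F.card := by
    rw [← Finset.sum_fiberwise_of_maps_to hmaps, Finset.sum_congr rfl fun l hl => hfib l hl _]
    calc _ ≤ ∑ l ∈ U.image (fun x => latticeQuot a (x + t)), β * (latticeBox a).card :=
          (norm_sum_le _ _).trans (Finset.sum_le_sum fun l _ => hl l)
      _ = β * U.card := by rw [Finset.sum_const, nsmul_eq_mul, hcard]; push_cast; ring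
      _ ≤ _ := by gcongr; exact Finset.filter_subset _ _
  rw [← Finset.sum_filter_add_sum_filter_not F
    (fun x => ∀ i ∈ latticeBox a, i + a * latticeQuot a (x + t) - t ∈ F)]
  refine (norm_add_le _ _).trans (add_le_add h1 ?_)
  refine (norm_sum_le _ _).trans ((Finset.sum_le_sum fun x _ => hφ x).trans ?_)
  simp [mul_comm]

/-- Two points of one tile differ by less than `a` in each coordinate, so a tile meeting the box at
`x` stays inside it once `x + a` and `x - a` do. -/
theorem card_filter_tile_not_subset_le {a b : Fin d → ℤ} (ha : ∀ i, 0 < a i) (hb : ∀ i, 0 < b i)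
    (t : Fin d → ℤ) :
    (((latticeBox b).filter fun x => ¬ ∀ i ∈ latticeBox a,
        i + a * latticeQuot a (x + t) - t ∈ latticeBox b).card : ℝ) ≤
      ((1 - overlapFrac b a) + (1 - overlapFrac b (-a))) * (latticeBox b).card := by
  rw [add_mul, ← card_filter_notMem_latticeBox hb, ← card_filter_notMem_latticeBox hb]
  norm_cast
  refine (Finset.card_le_card ?_).trans (Finset.card_union_le _ _)
  intro x hx
  rw [Finset.mem_filter] at hx
  rw [Finset.mem_union, Finset.mem_filter, Finset.mem_filter]
  by_contra! hcon
  have h1 := mem_latticeBox.1 (by simpa [hx.1] using hcon.1)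
  have h2 := mem_latticeBox.1 (by simpa [hx.1] using hcon.2)
  refine hx.2 fun i hi => mem_latticeBox.2 fun s => ?_
  have h3 := mem_latticeBox.1 hi s
  have h4 := mem_latticeBox.1 (latticeRem_mem ha (x + t)) s
  have h5 := congrFun (latticeRem_add_mul_latticeQuot a (x + t)) s
  have h6 := h1 s
  have h7 := h2 s
  simp only [Pi.add_apply, Pi.mul_apply, Pi.sub_apply, Pi.neg_apply] at h5 h6 h7 ⊢
  constructor <;> linarith [h3.1, h3.2, h4.1, h4.2, h6.1, h6.2, h7.1, h7.2]

end Lattice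

/-! ### Herglotz's theorem on the torus. -/

section Herglotz

/-- The measure is `c • ν`. Its variation is at most `‖c‖ • ν`, which gives integrability and lets
the formula pass from indicators to all integrable functions by density. -/
theorem MeasureTheory.Measure.exists_complexMeasure_integral_eq {X : Type*} [MeasurableSpace X]
    (ν : Measure X) [IsFiniteMeasure ν] (c : ℂ) :
    ∃ σ : ComplexMeasure X, ∀ f : X → ℂ, Integrable f ν →
      σ.Integrable f ∧ σ.integral f (ContinuousLinearMap.mul ℝ ℂ) = c * ∫ x, f x ∂ν := by
  let B : ℝ →L[ℝ] ℂ := (ContinuousLinearMap.id ℝ ℝ).smulRight c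
  let σ : ComplexMeasure X := ν.toSignedMeasure.mapRange (B : ℝ →ₗ[ℝ] ℂ).toAddMonoidHom B.continuous
  have hσ : ∀ s, MeasurableSet s → σ s = (ν.real s : ℂ) * c := by
    intro s hs
    simp [σ, B, Measure.toSignedMeasure_apply_measurable hs]
  have hvar : σ.variation ≤ (‖c‖₊ : ENNReal) • ν := by
    refine VectorMeasure.variation_le_of_forall_enorm_le fun s hs => ?_
    rw [hσ s hs, enorm_mul, Measure.smul_apply, smul_eq_mul, mul_comm]
    refine mul_le_mul' le_rfl ?_
    rw [← ofReal_norm]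
    simp [Measure.real]
  refine ⟨σ, fun f hf => ?_⟩
  have hT := (dominatedFinMeasAdditive_cbmApplyMeasure σ
    (ContinuousLinearMap.mul ℝ ℂ)).of_measure_le_smul ENNReal.coe_ne_top hvar (ContinuousLinearMap.opNorm_nonneg _)
  refine ⟨hf.of_measure_le_smul ENNReal.coe_ne_top hvar, ?_⟩
  rw [VectorMeasure.integral_eq_setToFun, ← setToFun_congr_measure_of_integrable (‖c‖₊ : ENNReal)
    ENNReal.coe_ne_top hvar hT _ f hf]
  refine hf.induction (P := fun f => setToFun ν _ hT f = c * ∫ x, f x ∂ν) ?_ ?_ ?_ ?_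
  · intro z s hs _
    rw [setToFun_indicator_const hT hs (measure_ne_top _ _), integral_indicator_const _ hs]
    change z * σ s = _
    rw [hσ s hs, Complex.real_smul]
    ring
  · intro f g _ hf hg hf' hg'
    rw [setToFun_add hT hf hg, hf', hg', ← mul_add]
    congr 1
    exact (integral_add hf hg).symm
  · exact isClosed_eq (continuous_setToFun hT) (continuous_const.mul continuous_integral)
  · intro f g hfg _ hf'
    rw [← setToFun_congr_ae hT hfg, hf', integral_congr_ae hfg]

theorem AddCircle.integral_fourier_haarAddCircle (n : ℤ) :
    ∫ x : UnitAddCircle, fourier n x ∂AddCircle.haarAddCircle = if n = 0 then 1 else 0 := by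
  split_ifs with h
  · simp [h]
  · exact integral_eq_zero_of_add_right_eq_neg (μ := AddCircle.haarAddCircle)
      (fourier_add_half_inv_index h one_pos)

namespace UnitAddTorus

variable {d : ℕ}

/-- The normalised Haar measure on the torus. -/
noncomputable abbrev haar (d : ℕ) : Measure (UnitAddTorus (Fin d)) :=
  Measure.pi fun _ => AddCircle.haarAddCircle

theorem integral_mFourier_haar (n : Fin d → ℤ) :
    ∫ x, mFourier n x ∂haar d = if n = 0 then 1 else 0 := by
  have h := integral_fintype_prod_eq_prod (𝕜 := ℂ) (fun i (x : UnitAddCircle) => fourier (n i) x)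
    (μ := fun _ : Fin d => AddCircle.haarAddCircle)
  simp only [mFourier, ContinuousMap.coe_mk, haar]
  rw [h]
  simp_rw [AddCircle.integral_fourier_haarAddCircle]
  rw [Finset.prod_ite_zero]
  simp [funext_iff]

theorem mFourier_sub_apply (j l : Fin d → ℤ) (x : UnitAddTorus (Fin d)) :
    mFourier (j - l) x = mFourier j x * (starRingEnd ℂ) (mFourier l x) := by
  rw [sub_eq_add_neg, mFourier_add, mFourier_neg]

theorem integrable_mFourier (n : Fin d → ℤ) (ν : Measure (UnitAddTorus (Fin d)))
    [IsFiniteMeasure ν] : Integrable (fun x => mFourier n x) ν :=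
  (mFourier n).continuous.integrable_of_hasCompactSupport (HasCompactSupport.of_compactSpace _)

/-- A function on `ℤ^d` is positive definite. -/
def IsPosDef (c : (Fin d → ℤ) → ℂ) : Prop :=
  ∀ (F : Finset (Fin d → ℤ)) (z : (Fin d → ℤ) → ℂ), ∃ r : ℝ, 0 ≤ r ∧
    ∑ j ∈ F, ∑ l ∈ F, c (j - l) * (z j * (starRingEnd ℂ) (z l)) = r

/-- The measure has a Fejér-type density with respect to Haar measure, nonnegative by positive
definiteness tested on the characters `j ↦ mFourier j x`. Orthogonality of characters leaves `c k`
once for each `l` with `l` and `l + k` in `F`. -/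
theorem IsPosDef.exists_fejer {c : (Fin d → ℤ) → ℂ} (hc : IsPosDef c)
    (F : Finset (Fin d → ℤ)) :
    ∃ ν : FiniteMeasure (UnitAddTorus (Fin d)), ∀ k, ∫ x, mFourier (-k) x ∂(ν : Measure _) =
      (((F.filter fun l => l + k ∈ F).card / F.card : ℝ) : ℂ) * c k := by
  set p : UnitAddTorus (Fin d) → ℂ := fun x =>
    (F.card : ℂ)⁻¹ * ∑ j ∈ F, ∑ l ∈ F, c (j - l) * mFourier (j - l) x with hp
  have hpc : Continuous p := by fun_prop
  have hpos : ∀ x, ((Real.toNNReal (p x).re : ℝ) : ℂ) = p x := by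
    intro x
    obtain ⟨r, hr, h⟩ := hc F fun j => mFourier j x
    have : p x = (((F.card : ℝ)⁻¹ * r : ℝ) : ℂ) := by
      simp only [hp, mFourier_sub_apply, h]
      push_cast; rfl
    rw [this, Complex.ofReal_re, Real.coe_toNNReal _ (by positivity)]
  have hfin : IsFiniteMeasure ((haar d).withDensity fun x => ENNReal.ofReal (p x).re) := by
    refine isFiniteMeasure_withDensity_ofReal ?_
    exact ((Complex.continuous_re.comp hpc).integrable_of_hasCompactSupport
      (HasCompactSupport.of_compactSpace _)).2
  refine ⟨⟨(haar d).withDensity fun x => ENNReal.ofReal (p x).re, hfin⟩, fun k => ?_⟩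
  change ∫ x, mFourier (-k) x ∂((haar d).withDensity fun x => (Real.toNNReal (p x).re : ENNReal)) = _
  rw [integral_withDensity_eq_integral_smul (by fun_prop)]
  have h1 : ∀ x, Real.toNNReal (p x).re • mFourier (-k) x =
      (F.card : ℂ)⁻¹ * ∑ l ∈ F, ∑ j ∈ F, c (j - l) * mFourier (j - l - k) x := by
    intro x
    rw [NNReal.smul_def, Complex.real_smul, hpos, hp, Finset.sum_comm]
    simp only [mul_assoc, Finset.sum_mul]
    simp only [sub_eq_add_neg _ k, mFourier_add]
  simp_rw [h1]
  rw [integral_const_mul, integral_finsetSum _ fun l _ => integrable_finsetSum _ fun j _ =>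
    (integrable_mFourier _ _).const_mul _]
  have h2 : ∀ l ∈ F, ∫ x, ∑ j ∈ F, c (j - l) * mFourier (j - l - k) x ∂haar d =
      if l + k ∈ F then c k else 0 := by
    intro l _
    rw [integral_finsetSum _ fun j _ => (integrable_mFourier _ _).const_mul _]
    simp_rw [integral_const_mul, integral_mFourier_haar]
    rw [← Finset.sum_ite_eq' F (l + k) fun _ => c k]
    refine Finset.sum_congr rfl fun j _ => ?_
    by_cases hj : j = l + k
    · simp [hj]
    · have : j - l - k ≠ 0 := fun h => hj (by rw [sub_sub, sub_eq_zero] at h; exact h)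
      simp [hj, this]
  rw [Finset.sum_congr rfl h2, ← Finset.sum_filter, Finset.sum_const, nsmul_eq_mul]
  push_cast
  ring

/-- Herglotz's theorem: a positive definite function on `ℤ^d` is the Fourier transform of a finite
measure on the torus. -/
theorem IsPosDef.exists_finiteMeasure {c : (Fin d → ℤ) → ℂ} (hc : IsPosDef c) :
    ∃ ν : FiniteMeasure (UnitAddTorus (Fin d)), ∀ k, ∫ x, mFourier (-k) x ∂(ν : Measure _) = c k := by
  choose ν hν using fun n : ℕ => hc.exists_fejer (latticeBox fun _ : Fin d => ((n + 1 : ℕ) : ℤ))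
  have hlim : ∀ k, Tendsto (fun n => ∫ x, mFourier (-k) x ∂(ν n : Measure _)) atTop (𝓝 (c k)) := by
    intro k
    have hu : ∀ i : Fin d, Tendsto (fun n : ℕ => ((n + 1 : ℕ) : ℤ)) atTop atTop := fun _ =>
      tendsto_natCast_atTop_atTop.comp (tendsto_add_atTop_nat 1)
    have h := (Complex.continuous_ofReal.tendsto 1).comp (tendsto_overlapFrac hu k)
    have h' := h.mul_const (c k)
    rw [Complex.ofReal_one, one_mul] at h'
    exact h'.congr fun n => (hν n k).symm
  have hmass : ∀ n, (ν n).mass ≤ (c 0).re.toNNReal := by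
    intro n
    have h := hν n 0
    have hne : ((latticeBox fun _ : Fin d => ((n + 1 : ℕ) : ℤ)).card : ℝ) ≠ 0 := by
      exact_mod_cast (card_latticeBox_pos fun _ => by positivity).ne'
    simp only [neg_zero, mFourier_zero, ContinuousMap.one_apply, integral_const, add_zero,
      Finset.filter_mem_eq_inter, Finset.inter_self] at h
    rw [div_self hne, Complex.ofReal_one, one_mul] at h
    rw [← h]
    refine le_of_eq (NNReal.eq ?_)
    rw [Real.coe_toNNReal _ (by simp)]
    simp only [Measure.real, Complex.real_smul, mul_one, Complex.ofReal_re]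
    rfl
  -- The coefficient at `0` fixes the total mass, so the Fejér measures stay in a weakly compact
  -- set; a limit along an ultrafilter suffices, since their coefficients already converge.
  obtain ⟨ν', -, hν'⟩ := (isCompact_setOfPred_finiteMeasure_le_of_compactSpace
    (UnitAddTorus (Fin d)) (c 0).re.toNNReal).ultrafilter_le_nhds
      ((Ultrafilter.of atTop).map ν) (by
        rw [le_principal_iff, Ultrafilter.coe_map, mem_map]
        exact univ_mem' hmass)
  have ht : Tendsto ν ((Ultrafilter.of atTop : Ultrafilter ℕ) : Filter ℕ) (𝓝 ν') := hν'
  refine ⟨ν', fun k => ?_⟩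
  have h1 := (FiniteMeasure.tendsto_iff_forall_integral_rclike_tendsto ℂ).1 ht
    (BoundedContinuousFunction.mkOfCompact (mFourier (-k)))
  exact tendsto_nhds_unique h1 ((hlim k).mono_left (Ultrafilter.of_le _))

end UnitAddTorus

end Herglotz

/-! ### Existence of spectral measures. -/

namespace QSubstitution

variable {d : ℕ} {A : Type*} (S : QSubstitution d A)

theorem shift_shift (k l : Fin d → ℤ) (a : S.subshift) :
    S.shift k (S.shift l a) = S.shift (k + l) a := by
  apply Subtype.ext
  funext j
  change a.1 (j + k + l) = a.1 (j + (k + l))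
  rw [add_assoc]

theorem norm_cylinderIndicator_le (α : A) (a : S.subshift) : ‖S.cylinderIndicator α a‖ ≤ 1 := by
  unfold cylinderIndicator
  by_cases h : a ∈ {a : S.subshift | a.1 0 = α}
  · simp [Set.indicator_of_mem h]
  · simp [Set.indicator_of_notMem h]

variable [MeasurableSpace A] {S} {μ : Measure S.subshift}

theorem ShiftInvariant.integral_comp_shift (hμ : S.ShiftInvariant μ) (k : Fin d → ℤ)
    {h : S.subshift → ℂ} (hm : Measurable h) : ∫ a, h (S.shift k a) ∂μ = ∫ a, h a ∂μ := by
  conv_rhs => rw [← (hμ k).map_eq]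
  rw [integral_map (hμ k).measurable.aemeasurable hm.aestronglyMeasurable]

variable [IsProbabilityMeasure μ]

/-- By invariance the quadratic form is the integral of `|∑ z_j h ∘ T^{-j}|²`. -/
theorem ShiftInvariant.isPosDef (hμ : S.ShiftInvariant μ) {h : S.subshift → ℂ} (hm : Measurable h)
    {C : ℝ} (hC : ∀ a, ‖h a‖ ≤ C) :
    UnitAddTorus.IsPosDef fun k => ∫ a, h (S.shift (-k) a) * (starRingEnd ℂ) (h a) ∂μ := by
  intro F z
  have hms : ∀ k, Measurable fun a => h (S.shift k a) := fun k => hm.comp (hμ k).measurable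
  have hint : ∀ j l, Integrable
      (fun a => h (S.shift (-j) a) * (starRingEnd ℂ) (h (S.shift (-l) a))) μ := by
    intro j l
    refine Integrable.of_bound (C := C * C)
      ((hms _).mul (Complex.continuous_conj.measurable.comp (hms _))).aestronglyMeasurable
      (Filter.Eventually.of_forall fun a => ?_)
    rw [norm_mul, RCLike.norm_conj]
    exact mul_le_mul (hC _) (hC _) (norm_nonneg _) ((norm_nonneg _).trans (hC a))
  have hc : ∀ j l, ∫ a, h (S.shift (-(j - l)) a) * (starRingEnd ℂ) (h a) ∂μ =
      ∫ a, h (S.shift (-j) a) * (starRingEnd ℂ) (h (S.shift (-l) a)) ∂μ := by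
    intro j l
    rw [← hμ.integral_comp_shift (-l)
      (h := fun a => h (S.shift (-(j - l)) a) * (starRingEnd ℂ) (h a))
      ((hms _).mul (Complex.continuous_conj.measurable.comp hm))]
    simp only [S.shift_shift]
    rw [show -(j - l) + -l = -j by abel]
  refine ⟨∫ a, Complex.normSq (∑ j ∈ F, z j * h (S.shift (-j) a)) ∂μ,
    integral_nonneg fun a => Complex.normSq_nonneg _, ?_⟩
  rw [← integral_complex_ofReal]
  have h1 : ∀ a, ((Complex.normSq (∑ j ∈ F, z j * h (S.shift (-j) a)) : ℝ) : ℂ) =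
      ∑ j ∈ F, ∑ l ∈ F, h (S.shift (-j) a) * (starRingEnd ℂ) (h (S.shift (-l) a)) *
        (z j * (starRingEnd ℂ) (z l)) := by
    intro a
    rw [← Complex.mul_conj, map_sum, Finset.sum_mul_sum]
    refine Finset.sum_congr rfl fun j _ => Finset.sum_congr rfl fun l _ => ?_
    rw [map_mul]; ring
  simp only [hc, h1]
  rw [integral_finsetSum _ fun j _ => integrable_finsetSum _ fun l _ => (hint j l).mul_const _]
  refine Finset.sum_congr rfl fun j _ => ?_
  rw [integral_finsetSum _ fun l _ => (hint j l).mul_const _]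
  exact Finset.sum_congr rfl fun l _ => (integral_mul_const _ _).symm

/-- Polarization: the correlation of `f` and `g` is `1/4` of the sum over `m < 4` of `I^m` times the
autocorrelation of `f + I^m g`. -/
theorem ShiftInvariant.exists_isSpectralMeasure (hμ : S.ShiftInvariant μ) {f g : S.subshift → ℂ}
    (hf : Measurable f) (hg : Measurable g) {C : ℝ} (hfC : ∀ a, ‖f a‖ ≤ C) (hgC : ∀ a, ‖g a‖ ≤ C) :
    ∃ σ, S.IsSpectralMeasure μ f g σ := by
  let h : Fin 4 → S.subshift → ℂ := fun m a => f a + Complex.I ^ (m : ℕ) * g a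
  have hm : ∀ m, Measurable (h m) := fun m => hf.add (hg.const_mul _)
  have hC : ∀ m a, ‖h m a‖ ≤ C + C := by
    intro m a
    refine (norm_add_le _ _).trans (add_le_add (hfC a) ?_)
    simpa using hgC a
  choose ν hν using fun m => (hμ.isPosDef (hm m) (hC m)).exists_finiteMeasure
  choose σ hσ using fun m : Fin 4 =>
    (ν m : Measure (UnitAddTorus (Fin d))).exists_complexMeasure_integral_eq
      (Complex.I ^ (m : ℕ) / 4)
  refine ⟨∑ m, σ m, fun k => ?_⟩
  have hi : ∀ m, Integrable (fun x => UnitAddTorus.mFourier (-k) x)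
      (ν m : Measure (UnitAddTorus (Fin d))) := fun m => UnitAddTorus.integrable_mFourier _ _
  rw [torusFourierCoeff, VectorMeasure.integral_finsetSum_vectorMeasure
    fun m _ => (hσ m _ (hi m)).1]
  simp_rw [fun m => (hσ m _ (hi m)).2, hν, ← integral_const_mul]
  rw [← integral_finsetSum]
  · refine integral_congr_ae (Filter.Eventually.of_forall fun a => ?_)
    simp only [h, Fin.sum_univ_four, map_add, map_mul, map_pow, Complex.conj_I]
    simp only [Fin.val_zero, Fin.val_one, Fin.val_two, pow_zero, pow_one,
      show ((3 : Fin 4) : ℕ) = 3 from rfl, Complex.I_sq, Complex.I_pow_three, neg_sq]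
    have h3 : (-Complex.I) ^ 3 = Complex.I := by
      rw [Odd.neg_pow (by decide), Complex.I_pow_three, neg_neg]
    rw [h3]
    ring_nf
    simp only [Complex.I_sq]
    ring
  · intro m _
    refine (Integrable.of_bound (C := (C + C) * (C + C))
      (((hm m).comp (hμ (-k)).measurable).mul
        (Complex.continuous_conj.measurable.comp (hm m))).aestronglyMeasurable
      (Filter.Eventually.of_forall fun a => ?_)).const_mul _
    simp only [Function.comp_apply, Pi.mul_apply, norm_mul, RCLike.norm_conj]
    exact mul_le_mul (hC _ _) (hC _ _) (norm_nonneg _) ((norm_nonneg _).trans (hC m a))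

theorem measurable_eval (j : Fin d → ℤ) : Measurable fun a : S.subshift => a.1 j :=
  (measurable_pi_apply j).comp measurable_subtype_coe

variable [DiscreteMeasurableSpace A]

theorem measurable_cylinderIndicator (α : A) : Measurable (S.cylinderIndicator α) :=
  measurable_one.indicator (measurable_eval 0 (MeasurableSet.of_discrete (s := {α})))

theorem ShiftInvariant.isSpectralMeasure_correlationMeasure (hμ : S.ShiftInvariant μ) (α β : A) :
    S.IsSpectralMeasure μ (S.cylinderIndicator α) (S.cylinderIndicator β)
      (S.correlationMeasure μ α β) :=
  Classical.epsilon_spec (hμ.exists_isSpectralMeasure (measurable_cylinderIndicator α)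
    (measurable_cylinderIndicator β) (S.norm_cylinderIndicator_le α) (S.norm_cylinderIndicator_le β))

end QSubstitution

/-! ### Letter and pair frequencies in substituted words. -/

namespace QSubstitution

variable {d : ℕ} {A : Type*} (S : QSubstitution d A)

theorem q_pow_pos (n : ℕ) (i : Fin d) : 0 < (S.q ^ n) i := pow_pos (S.q_pos i) n

theorem card_latticeBox_q_pow (n : ℕ) : ((latticeBox (S.q ^ n)).card : ℤ) = S.Q ^ n := by
  rw [card_latticeBox fun i => (S.q_pow_pos n i).le, Q, ← Finset.prod_pow]
  rfl

theorem card_latticeBox_q_pow_complex (n : ℕ) :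
    ((latticeBox (S.q ^ n)).card : ℂ) = (S.Q : ℂ) ^ n := by
  exact_mod_cast congrArg (Int.cast : ℤ → ℂ) (S.card_latticeBox_q_pow n)

theorem Q_pos : 0 < S.Q := Finset.prod_pos fun i _ => S.q_pos i

theorem Q_pow_ne_zero (n : ℕ) : (S.Q : ℂ) ^ n ≠ 0 :=
  pow_ne_zero _ (by exact_mod_cast S.Q_pos.ne')

theorem genInstruction_congr {n : ℕ} {x y : Fin d → ℤ}
    (h : latticeRem (S.q ^ n) x = latticeRem (S.q ^ n) y) :
    S.genInstruction n x = S.genInstruction n y := by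
  rw [← S.genInstruction_latticeRem, h, S.genInstruction_latticeRem]

theorem genInstruction_add_mul (n : ℕ) (x l : Fin d → ℤ) :
    S.genInstruction n (x + S.q ^ n * l) = S.genInstruction n x :=
  S.genInstruction_congr (latticeRem_add_mul _ _ _)

theorem genInstruction_add (p n : ℕ) (x : Fin d → ℤ) :
    S.genInstruction (p + n) x =
      S.genInstruction p x ∘ S.genInstruction n (latticeQuot (S.q ^ p) x) := by
  induction p generalizing x with
  | zero =>
    have : latticeQuot (S.q ^ 0) x = x := by funext i; simp [latticeQuot]
    rw [zero_add, this]
    rfl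
  | succ p ih =>
    rw [Nat.succ_add, pow_succ', latticeQuot_mul S.q_pos]
    simp only [genInstruction, ih, Function.comp_assoc]

/-- The sequence obtained from `b` by `n` substitutions. -/
noncomputable def inflate (n : ℕ) (b : (Fin d → ℤ) → A) (x : Fin d → ℤ) : A :=
  S.genInstruction n x (b (latticeQuot (S.q ^ n) x))

theorem inflate_add_mul (n : ℕ) (b : (Fin d → ℤ) → A) (x l : Fin d → ℤ) :
    S.inflate n b (x + S.q ^ n * l) =
      S.genInstruction n x (b (latticeQuot (S.q ^ n) x + l)) := by
  rw [inflate, genInstruction_add_mul, latticeQuot_add_mul (S.q_pow_pos n)]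

theorem genInstruction_add_apply (n m : ℕ) (x : Fin d → ℤ) (γ : A) :
    S.genInstruction (n + m) x γ = S.inflate n (fun l => S.genInstruction m l γ) x := by
  rw [genInstruction_add]
  rfl

/-- Every finite part of an element of the subshift is the translate of a part of an `n`-fold
substituted sequence. -/
theorem exists_inflate (hd : 1 ≤ d) (a : S.subshift) (n : ℕ) (F : Finset (Fin d → ℤ)) :
    ∃ t b, ∀ x ∈ F, a.1 x = S.inflate n b (x + t) := by
  classical
  let e : Fin d → ℤ := S.q ^ n
  -- The points `0` and `q^n` force the ambient word `S^m(γ)` to have side at least `q^n` in one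
  -- coordinate, hence `n ≤ m`; then `S^m(γ)` is `S^n` applied to `S^(m-n)(γ)`.
  let B : Finset (Fin d → ℤ) := insert 0 (insert e F)
  obtain ⟨-, m, γ, s, hs⟩ := a.2 (fun x => if x ∈ B then some (a.1 x) else none)
    (B.finite_toSet.subset fun x hx => by
      by_contra hxB
      exact hx (if_neg hxB))
    ⟨0, fun j b hb => by
      simp only [PartialSeq.shift, add_zero] at hb
      split_ifs at hb
      exact hb⟩
  have hB : ∀ x ∈ B, x - s ∈ latticeBox (S.q ^ m) ∧ S.genInstruction m (x - s) γ = a.1 x := by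
    intro x hx
    have h := hs (x - s) (a.1 x) (by simp [PartialSeq.shift, hx])
    rw [act_iterate_letter] at h
    split_ifs at h with h'
    exact ⟨h', Option.some.inj h⟩
  have hnm : n ≤ m := by
    have h0 := mem_latticeBox.1 (hB 0 (by simp [B])).1 ⟨0, hd⟩
    have h1 := mem_latticeBox.1 (hB e (by simp [B])).1 ⟨0, hd⟩
    simp only [Pi.sub_apply, Pi.zero_apply, Pi.pow_apply, e] at h0 h1
    refine (pow_le_pow_iff_right₀ (S.one_lt_q ⟨0, hd⟩)).1 ?_
    linarith [h0.1, h1.2]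
  obtain ⟨m', rfl⟩ := Nat.exists_eq_add_of_le hnm
  refine ⟨-s, fun l => S.genInstruction m' l γ, fun x hx => ?_⟩
  rw [← genInstruction_add_apply, ← sub_eq_add_neg]
  exact (hB x (by simp [B, hx])).2.symm

variable [DecidableEq A]

/-- The indicator that the pair `(x, y)` equals `p`. -/
def pairInd (p : A × A) (x y : A) : ℂ := if p.1 = x ∧ p.2 = y then 1 else 0

omit [DecidableEq A] in
theorem norm_ite_one_zero_le (P : Prop) [Decidable P] : ‖(if P then 1 else 0 : ℂ)‖ ≤ 1 := by
  split_ifs <;> simp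

theorem norm_pairInd_le (p : A × A) (x y : A) : ‖pairInd p x y‖ ≤ 1 := norm_ite_one_zero_le _

/-- The frequencies of the pairs at distance `k` in the words `S^n(γ)`, extended periodically. -/
noncomputable def pairFreq (n : ℕ) (k : Fin d → ℤ) : Matrix (A × A) A ℂ :=
  Matrix.of fun p γ => ((S.Q : ℂ) ^ n)⁻¹ * ∑ j ∈ latticeBox (S.q ^ n),
    pairInd p (S.genInstruction n j γ) (S.genInstruction n (j + k) γ)

/-- The frequencies of the letters in the words `S^n(γ)`. -/
noncomputable def letterFreq (n : ℕ) : Matrix A A ℂ :=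
  ((S.Q : ℂ) ^ n)⁻¹ • ∑ j ∈ latticeBox (S.q ^ n), S.instructionMatrix n j

omit [DecidableEq A] in
theorem norm_inv_mul_sum_le (n : ℕ) {c : ℝ} {f : (Fin d → ℤ) → ℂ} (hf : ∀ j, ‖f j‖ ≤ c) :
    ‖((S.Q : ℂ) ^ n)⁻¹ * ∑ j ∈ latticeBox (S.q ^ n), f j‖ ≤ c := by
  rw [← card_latticeBox_q_pow_complex, norm_mul, norm_inv, Complex.norm_natCast, inv_mul_le_iff₀
    (by exact_mod_cast card_latticeBox_pos (S.q_pow_pos n))]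
  refine (norm_sum_le _ _).trans ((Finset.sum_le_sum fun j _ => hf j).trans ?_)
  simp

theorem norm_pairFreq_le (n : ℕ) (k : Fin d → ℤ) (p : A × A) (γ : A) :
    ‖S.pairFreq n k p γ‖ ≤ 1 :=
  S.norm_inv_mul_sum_le n fun _ => norm_pairInd_le _ _ _

theorem letterFreq_apply (n : ℕ) (α γ : A) : S.letterFreq n α γ =
    ((S.Q : ℂ) ^ n)⁻¹ * ∑ j ∈ latticeBox (S.q ^ n),
      if α = S.genInstruction n j γ then 1 else 0 := by
  simp [letterFreq, Matrix.sum_apply, instructionMatrix]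

theorem norm_letterFreq_le (n : ℕ) (α γ : A) : ‖S.letterFreq n α γ‖ ≤ 1 := by
  rw [letterFreq_apply]
  exact S.norm_inv_mul_sum_le n fun _ => norm_ite_one_zero_le _

theorem pairFreq_zero_diag (n : ℕ) (α γ : A) :
    S.pairFreq n 0 (α, α) γ = S.letterFreq n α γ := by
  simp [letterFreq_apply, pairFreq, pairInd]

/-- Both letters of a pair are read in the same word `S^n(b l)` unless `i + k` leaves the tile; each
exception costs at most `1`. -/
theorem norm_sum_pairInd_inflate_sub_le (n : ℕ) (k : Fin d → ℤ) (b : (Fin d → ℤ) → A) (p : A × A)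
    (l : Fin d → ℤ) :
    ‖∑ i ∈ latticeBox (S.q ^ n), (pairInd p (S.inflate n b (i + S.q ^ n * l))
        (S.inflate n b (i + S.q ^ n * l + k)) - S.pairFreq n k p (b l))‖ ≤
      (1 - overlapFrac (S.q ^ n) k) * (latticeBox (S.q ^ n)).card := by
  rw [← card_filter_notMem_latticeBox (S.q_pow_pos n), Finset.sum_sub_distrib, Finset.sum_const,
    nsmul_eq_mul, card_latticeBox_q_pow_complex, pairFreq, Matrix.of_apply,
    mul_inv_cancel_left₀ (S.Q_pow_ne_zero n), ← Finset.sum_sub_distrib]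
  have h : ∀ i ∈ latticeBox (S.q ^ n), ‖pairInd p (S.inflate n b (i + S.q ^ n * l))
      (S.inflate n b (i + S.q ^ n * l + k)) -
      pairInd p (S.genInstruction n i (b l)) (S.genInstruction n (i + k) (b l))‖ ≤
      if i + k ∉ latticeBox (S.q ^ n) then 1 else 0 := by
    intro i hi
    rw [add_right_comm, inflate_add_mul, inflate_add_mul, latticeQuot_of_mem hi, zero_add]
    split_ifs with hk
    · rw [latticeQuot_of_mem (not_not.1 (by simpa using hk)), zero_add, sub_self, norm_zero]
    · unfold pairInd
      split_ifs <;> simp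
  refine (norm_sum_le _ _).trans ((Finset.sum_le_sum h).trans ?_)
  rw [Finset.sum_boole]

variable [Fintype A]

theorem pairFreq_mul_letterFreq_apply (n m : ℕ) (k : Fin d → ℤ) (p : A × A) (γ : A) :
    (S.pairFreq n k * S.letterFreq m) p γ = ((S.Q : ℂ) ^ m)⁻¹ * ∑ l ∈ latticeBox (S.q ^ m),
      S.pairFreq n k p (S.genInstruction m l γ) := by
  simp only [Matrix.mul_apply, letterFreq_apply, Finset.mul_sum]
  rw [Finset.sum_comm]
  refine Finset.sum_congr rfl fun l _ => ?_
  simp [mul_comm]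

/-- `S^(n+m)(γ)` is tiled by the words `S^n` of the letters of `S^m(γ)`, and only pairs straddling
two tiles are miscounted. The bound does not depend on `m`. -/
theorem norm_pairFreq_sub_le (n m : ℕ) (k : Fin d → ℤ) (p : A × A) (γ : A) :
    ‖S.pairFreq (n + m) k p γ - (S.pairFreq n k * S.letterFreq m) p γ‖ ≤
      1 - overlapFrac (S.q ^ n) k := by
  set f : (Fin d → ℤ) → (Fin d → ℤ) → ℂ := fun l i =>
    pairInd p (S.inflate n (fun l => S.genInstruction m l γ) (i + S.q ^ n * l))
      (S.inflate n (fun l => S.genInstruction m l γ) (i + S.q ^ n * l + k)) with hf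
  have h1 : S.pairFreq (n + m) k p γ = ((S.Q : ℂ) ^ m)⁻¹ * ∑ l ∈ latticeBox (S.q ^ m),
      ((S.Q : ℂ) ^ n)⁻¹ * ∑ i ∈ latticeBox (S.q ^ n), f l i := by
    rw [pairFreq, Matrix.of_apply, pow_add S.q, sum_latticeBox_mul (S.q_pow_pos n), Finset.sum_comm,
      pow_add, mul_inv, mul_comm (((S.Q : ℂ) ^ n)⁻¹), mul_assoc, Finset.mul_sum]
    simp only [genInstruction_add_apply, hf]
  have h2 : ∀ l, ((S.Q : ℂ) ^ n)⁻¹ * ∑ i ∈ latticeBox (S.q ^ n), f l i -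
      S.pairFreq n k p (S.genInstruction m l γ) = ((S.Q : ℂ) ^ n)⁻¹ *
        ∑ i ∈ latticeBox (S.q ^ n), (f l i - S.pairFreq n k p (S.genInstruction m l γ)) := by
    intro l
    rw [Finset.sum_sub_distrib, Finset.sum_const, nsmul_eq_mul, card_latticeBox_q_pow_complex,
      mul_sub, inv_mul_cancel_left₀ (S.Q_pow_ne_zero n)]
  rw [h1, pairFreq_mul_letterFreq_apply, ← mul_sub, ← Finset.sum_sub_distrib]
  refine S.norm_inv_mul_sum_le m fun l => ?_
  rw [h2]
  have hc : (0 : ℝ) < (latticeBox (S.q ^ n)).card := by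
    exact_mod_cast card_latticeBox_pos (S.q_pow_pos n)
  rw [← card_latticeBox_q_pow_complex, norm_mul, norm_inv, Complex.norm_natCast,
    inv_mul_le_iff₀ hc, mul_comm]
  exact S.norm_sum_pairInd_inflate_sub_le n k _ p l

theorem instructionMatrix_add (p n : ℕ) (x : Fin d → ℤ) : S.instructionMatrix (p + n) x =
    S.instructionMatrix p x * S.instructionMatrix n (latticeQuot (S.q ^ p) x) := by
  ext α γ
  simp [Matrix.mul_apply, instructionMatrix, genInstruction_add]

omit [Fintype A] in
theorem instructionMatrix_add_mul (n : ℕ) (x l : Fin d → ℤ) :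
    S.instructionMatrix n (x + S.q ^ n * l) = S.instructionMatrix n x := by
  simp only [instructionMatrix, genInstruction_add_mul]

theorem letterFreq_add (p n : ℕ) : S.letterFreq (p + n) = S.letterFreq p * S.letterFreq n := by
  rw [letterFreq, letterFreq, letterFreq, smul_mul_smul_comm, pow_add S.q, pow_add,
    mul_inv, sum_latticeBox_mul (S.q_pow_pos p), Finset.sum_mul_sum]
  congr 1
  refine Finset.sum_congr rfl fun i hi => Finset.sum_congr rfl fun l _ => ?_
  rw [instructionMatrix_add, instructionMatrix_add_mul, latticeQuot_add_mul (S.q_pow_pos p),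
    latticeQuot_of_mem hi, zero_add]

theorem letterFreq_eq_pow (n : ℕ) : S.letterFreq n = S.letterFreq 1 ^ n := by
  induction n with
  | zero =>
    ext α γ
    have h : ((latticeBox (S.q ^ 0)).card : ℂ) = 1 := by
      rw [card_latticeBox_q_pow_complex, pow_zero]
    have hg : ∀ j, S.genInstruction 0 j γ = γ := fun _ => rfl
    rw [letterFreq_apply, pow_zero (S.letterFreq 1), pow_zero (S.Q : ℂ), inv_one, one_mul,
      Matrix.one_apply]
    simp_rw [hg]
    rw [Finset.sum_const, nsmul_eq_mul, h, one_mul]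
  | succ n ih => rw [letterFreq_add, ih, pow_succ]

omit [Fintype A] in
theorem letterFreq_one : S.letterFreq 1 = (S.Q : ℂ)⁻¹ • S.substitutionMatrix := by
  ext α γ
  rw [letterFreq_apply, pow_one, pow_one, Matrix.smul_apply, smul_eq_mul, substitutionMatrix,
    Matrix.of_apply, ← Finset.sum_boole, ← Finset.sum_coe_sort]
  congr 1
  refine Finset.sum_congr rfl fun j _ => ?_
  have : S.genInstruction 1 j γ = S.word γ j := by
    simp only [genInstruction, instruction, Function.comp_apply, id, latticeRem_of_mem j.2]
  simp [this, eq_comm]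

theorem tendsto_letterFreq_mul_one_sub (hindex : S.imprimitivityIndex = 1) :
    Tendsto (fun m => S.letterFreq 1 ^ m * (1 - S.letterFreq 1)) atTop (𝓝 0) := by
  have hmem : (1 : ℕ) ∈ {h : ℕ | 0 < h ∧ ∀ z : ℂ,
      Module.End.HasEigenvalue (Matrix.toLin' S.substitutionMatrix) z →
        ‖z‖ = (S.Q : ℝ) → z ^ h = (S.Q : ℂ) ^ h} := by
    rw [← hindex]
    -- The infimum of the empty set is `0`, so index `1` is a genuine minimum.
    refine Nat.sInf_mem (Set.nonempty_iff_ne_empty.2 fun h => ?_)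
    rw [imprimitivityIndex, h, Nat.sInf_empty] at hindex
    exact zero_ne_one hindex
  refine Matrix.tendsto_pow_mul_one_sub (C := 1) (fun m i j => ?_) fun z hz hz1 => ?_
  · rw [← letterFreq_eq_pow]
    exact S.norm_letterFreq_le m i j
  · have hQ : (S.Q : ℂ) ≠ 0 := by exact_mod_cast S.Q_pos.ne'
    obtain ⟨v, hv⟩ := hz.exists_hasEigenvector
    have hv' : Matrix.toLin' S.substitutionMatrix v = ((S.Q : ℂ) * z) • v := by
      have h := hv.apply_eq_smul
      rw [letterFreq_one, map_smul, LinearMap.smul_apply, inv_smul_eq_iff₀ hQ] at h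
      rw [h, smul_smul]
    have h := hmem.2 _ (Module.End.hasEigenvalue_of_hasEigenvector
      (Module.End.hasEigenvector_iff.2 ⟨Module.End.mem_eigenspace_iff.2 hv', hv.2⟩)) (by
        rw [norm_mul, hz1, mul_one, Complex.norm_intCast, abs_of_pos (by exact_mod_cast S.Q_pos)])
    rw [pow_one, pow_one] at h
    exact mul_left_cancel₀ hQ (h.trans (mul_one _).symm)

end QSubstitution

/-! ### Means of approximate convex combinations. -/

section Convexity

variable {ι A X : Type*} [Fintype ι] [Fintype A] [MeasurableSpace X]

/-- If every value of a vector valued function is approximated by convex combinations of the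
columns of a matrix, then so is its mean. -/
theorem exists_stdSimplex_norm_integral_sub_le {μ : Measure X} [IsProbabilityMeasure μ]
    (c : Matrix ι A ℂ) {ε : ι → ℝ} {Φ : X → ι → ℂ} (hΦ : ∀ i, Integrable (fun x => Φ x i) μ)
    (h : ∀ x, ∃ w ∈ stdSimplex ℝ A, ∀ i, ‖Φ x i - ∑ γ, c i γ * (w γ : ℂ)‖ ≤ ε i) :
    ∃ w ∈ stdSimplex ℝ A, ∀ i, ‖∫ x, Φ x i ∂μ - ∑ γ, c i γ * (w γ : ℂ)‖ ≤ ε i := by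
  let L : (A → ℝ) × (ι → ℂ) →ₗ[ℝ] ι → ℂ :=
    { toFun := fun p i => ∑ γ, c i γ * (p.1 γ : ℂ) + p.2 i
      map_add' := by
        intro p q; funext i
        simp only [Prod.fst_add, Prod.snd_add, Pi.add_apply, Complex.ofReal_add, mul_add,
          Finset.sum_add_distrib]
        ring
      map_smul' := by
        intro r p; funext i
        simp only [Prod.smul_fst, Prod.smul_snd, Pi.smul_apply, smul_eq_mul, Complex.ofReal_mul,
          RingHom.id_apply, Complex.real_smul, mul_add, Finset.mul_sum]
        congr 1
        exact Finset.sum_congr rfl fun γ _ => by ring }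
  -- The admissible values form the image under `L` of a compact convex set of weights and errors;
  -- being closed and convex, it contains the mean.
  let s : Set ((A → ℝ) × (ι → ℂ)) :=
    stdSimplex ℝ A ×ˢ Set.univ.pi fun i => Metric.closedBall (0 : ℂ) (ε i)
  have hs : IsCompact s :=
    (isCompact_stdSimplex ℝ A).prod (isCompact_univ_pi fun i => isCompact_closedBall 0 (ε i))
  have hsc : Convex ℝ s :=
    (convex_stdSimplex ℝ A).prod (convex_pi fun i _ => convex_closedBall 0 (ε i))
  have hL : Continuous L := L.continuous_of_finiteDimensional
  have hmem : ∀ x, Φ x ∈ L '' s := by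
    intro x
    obtain ⟨w, hw, hwε⟩ := h x
    refine ⟨(w, fun i => Φ x i - ∑ γ, c i γ * (w γ : ℂ)), ⟨hw, fun i _ => ?_⟩, ?_⟩
    · rw [mem_closedBall_zero_iff]
      exact hwε i
    · funext i
      simp [L]
  have hint : Integrable Φ μ := Integrable.of_eval hΦ
  obtain ⟨⟨w, e⟩, ⟨hw, he⟩, hwe⟩ := (hsc.linear_image L).integral_mem (hs.image hL).isClosed
    (Filter.Eventually.of_forall hmem) hint
  refine ⟨w, hw, fun i => ?_⟩
  have hi := congrFun hwe i
  rw [eval_integral hΦ] at hi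
  rw [← hi]
  simpa [L] using he i trivial

end Convexity

/-! ### From box averages to the coefficients of the invariant measure. -/

namespace QSubstitution

variable {d : ℕ} {A : Type*} (S : QSubstitution d A) [DecidableEq A] [Fintype A]

/-- The word frequencies in a large box are approximated by those in the words `S^n(γ)`. -/
theorem exists_stdSimplex_norm_average_sub_le (n : ℕ) {N : Fin d → ℤ} (hN : ∀ i, 0 < N i)
    (b : (Fin d → ℤ) → A) (t : Fin d → ℤ) :
    ∃ w ∈ stdSimplex ℝ A, ∀ (k : Fin d → ℤ) (p : A × A),
      ‖((latticeBox N).card : ℂ)⁻¹ * ∑ x ∈ latticeBox N, pairInd p (S.inflate n b (x + t))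
          (S.inflate n b (x + k + t)) - ∑ γ, S.pairFreq n k p γ * (w γ : ℂ)‖ ≤
        (1 - overlapFrac (S.q ^ n) k) +
          2 * ((1 - overlapFrac N (S.q ^ n)) + (1 - overlapFrac N (-S.q ^ n))) := by
  set F := latticeBox N with hF
  have hFpos : (0 : ℝ) < F.card := by exact_mod_cast card_latticeBox_pos hN
  have hFne : (F.card : ℂ) ≠ 0 := by exact_mod_cast hFpos.ne'
  -- The weight of `γ` is the proportion of points of the box whose tile comes from the letter `γ`;
  -- it depends on neither `k` nor `p`.
  refine ⟨fun γ => (F.filter fun x => b (latticeQuot (S.q ^ n) (x + t)) = γ).card / F.card,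
    ⟨fun γ => by positivity, ?_⟩, fun k p => ?_⟩
  · rw [← Finset.sum_div, div_eq_one_iff_eq hFpos.ne']
    norm_cast
    exact (Finset.card_eq_sum_card_fiberwise fun x _ => Finset.mem_coe.2 (Finset.mem_univ _)).symm
  set φ : (Fin d → ℤ) → ℂ := fun x => pairInd p (S.inflate n b (x + t))
    (S.inflate n b (x + t + k)) - S.pairFreq n k p (b (latticeQuot (S.q ^ n) (x + t))) with hφ
  have h1 : ((F.card : ℂ)⁻¹ * ∑ x ∈ F, pairInd p (S.inflate n b (x + t))
      (S.inflate n b (x + k + t)) - ∑ γ, S.pairFreq n k p γ *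
        (((F.filter fun x => b (latticeQuot (S.q ^ n) (x + t)) = γ).card / F.card : ℝ) : ℂ)) =
      (F.card : ℂ)⁻¹ * ∑ x ∈ F, φ x := by
    rw [hφ, Finset.sum_sub_distrib, mul_sub]
    congr 1
    · simp only [add_right_comm _ k t]
    · rw [← Finset.sum_fiberwise F (fun x => b (latticeQuot (S.q ^ n) (x + t))), Finset.mul_sum]
      refine Finset.sum_congr rfl fun γ _ => ?_
      rw [Finset.sum_congr rfl fun x hx => by rw [(Finset.mem_filter.1 hx).2], Finset.sum_const,
        nsmul_eq_mul]
      push_cast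
      ring
  have hov : (0 : ℝ) ≤ 1 - overlapFrac (S.q ^ n) k := sub_nonneg.2
    (div_le_one_of_le₀ (by exact_mod_cast Finset.card_filter_le _ _) (by positivity))
  have h2 := norm_sum_le_of_tiles (S.q_pow_pos n) F t (φ := φ) hov
    (fun x => by
      refine (norm_sub_le _ _).trans ?_
      linarith [norm_pairInd_le p (S.inflate n b (x + t)) (S.inflate n b (x + t + k)),
        S.norm_pairFreq_le n k p (b (latticeQuot (S.q ^ n) (x + t)))])
    (fun l => by
      refine le_trans (le_of_eq ?_) (S.norm_sum_pairInd_inflate_sub_le n k b p l)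
      congr 1
      refine Finset.sum_congr rfl fun i hi => ?_
      simp only [hφ, sub_add_cancel, latticeQuot_add_mul (S.q_pow_pos n), latticeQuot_of_mem hi,
        zero_add])
  rw [h1, norm_mul, norm_inv, Complex.norm_natCast, inv_mul_le_iff₀ hFpos]
  have h3 := card_filter_tile_not_subset_le (S.q_pow_pos n) hN t
  linarith

variable [MeasurableSpace A] [DiscreteMeasurableSpace A] {S} {μ : Measure S.subshift}
  [IsProbabilityMeasure μ]

omit [Fintype A] [IsProbabilityMeasure μ] in
theorem measurable_pairInd_eval (p : A × A) (x y : Fin d → ℤ) :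
    Measurable fun a : S.subshift => pairInd p (a.1 x) (a.1 y) := by
  unfold pairInd
  refine Measurable.ite ?_ measurable_const measurable_const
  exact (measurable_eval x (MeasurableSet.of_discrete (s := {z | p.1 = z}))).inter
    (measurable_eval y (MeasurableSet.of_discrete (s := {z | p.2 = z})))

omit [Fintype A] in
theorem ShiftInvariant.correlationVectorCoeff_eq (hμ : S.ShiftInvariant μ) (k x : Fin d → ℤ)
    (p : A × A) :
    S.correlationVectorCoeff μ k p = ∫ a, pairInd p (a.1 x) (a.1 (x + k)) ∂μ := by
  have h1 : ∀ a : S.subshift, S.cylinderIndicator p.1 (S.shift (-k) a) *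
      (starRingEnd ℂ) (S.cylinderIndicator p.2 a) = pairInd p (a.1 (-k)) (a.1 0) := by
    intro a
    simp only [cylinderIndicator, pairInd, Set.indicator_apply, Set.mem_ofPred_eq, shift, zero_add,
      Pi.one_apply, eq_comm (a := p.1), eq_comm (a := p.2)]
    split_ifs <;> simp_all
  rw [correlationVectorCoeff, hμ.isSpectralMeasure_correlationMeasure p.1 p.2 k]
  simp_rw [h1]
  rw [← hμ.integral_comp_shift (x + k) (measurable_pairInd_eval p (-k) 0)]
  simp [shift, add_comm]

/-- The Boolean index makes one weight vector serve the distances `k` and `0` at once, which ties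
pair frequencies to letter frequencies. -/
theorem ShiftInvariant.exists_stdSimplex_norm_sub_le (hμ : S.ShiftInvariant μ) (hd : 1 ≤ d)
    (k : Fin d → ℤ) (n : ℕ) {ε : ℝ} (hε : 0 < ε) :
    ∃ w ∈ stdSimplex ℝ A, ∀ i : Bool × A × A,
      ‖S.correlationVectorCoeff μ (if i.1 then k else 0) i.2 -
        ∑ γ, S.pairFreq n (if i.1 then k else 0) i.2 γ * (w γ : ℂ)‖ ≤
          (1 - overlapFrac (S.q ^ n) (if i.1 then k else 0)) + ε := by
  have hu : ∀ i : Fin d, Tendsto (fun n : ℕ => ((n + 1 : ℕ) : ℤ)) atTop atTop := fun _ =>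
    tendsto_natCast_atTop_atTop.comp (tendsto_add_atTop_nat 1)
  have hlim := ((((tendsto_overlapFrac hu (S.q ^ n)).const_sub 1).add
    ((tendsto_overlapFrac hu (-S.q ^ n)).const_sub 1)).const_mul 2)
  rw [sub_self, add_zero, mul_zero] at hlim
  -- The box is taken so large that the tiles crossing its boundary contribute less than `ε`.
  obtain ⟨M, hM⟩ := (hlim.eventually_lt_const hε).exists
  set N : Fin d → ℤ := fun _ => ((M + 1 : ℕ) : ℤ) with hNdef
  have hN : ∀ i, 0 < N i := fun i => by simp only [hNdef]; positivity
  set F := latticeBox N with hF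
  have hFne : (F.card : ℂ) ≠ 0 := by exact_mod_cast (card_latticeBox_pos hN).ne'
  set κ : Bool → Fin d → ℤ := fun s => if s then k else 0 with hκ
  have hi : ∀ p x y, Integrable (fun a : S.subshift => pairInd p (a.1 x) (a.1 y)) μ := fun p x y =>
    Integrable.of_bound (C := 1) (measurable_pairInd_eval p x y).aestronglyMeasurable
      (Filter.Eventually.of_forall fun a => norm_pairInd_le _ _ _)
  obtain ⟨w, hw, h⟩ := exists_stdSimplex_norm_integral_sub_le (μ := μ)
    (Matrix.of fun (i : Bool × A × A) γ => S.pairFreq n (κ i.1) i.2 γ)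
    (ε := fun i => (1 - overlapFrac (S.q ^ n) (κ i.1)) + ε)
    (Φ := fun a i => (F.card : ℂ)⁻¹ * ∑ x ∈ F, pairInd i.2 (a.1 x) (a.1 (x + κ i.1)))
    (fun i => (integrable_finsetSum _ fun x _ => hi _ _ _).const_mul _)
    (fun a => by
      obtain ⟨t, b, hb⟩ := S.exists_inflate hd a n (F ∪ F.image fun x => x + k)
      obtain ⟨w, hw, h⟩ := S.exists_stdSimplex_norm_average_sub_le n hN b t
      refine ⟨w, hw, fun i => ?_⟩
      refine le_trans (le_of_eq ?_) ((h (κ i.1) i.2).trans (add_le_add le_rfl hM.le))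
      congr 3
      refine Finset.sum_congr rfl fun x hx => ?_
      rw [hb x (Finset.mem_union_left _ hx), hb (x + κ i.1)]
      simp only [hκ]
      split_ifs
      · exact Finset.mem_union_right _ (Finset.mem_image_of_mem _ hx)
      · rw [add_zero]; exact Finset.mem_union_left _ hx)
  refine ⟨w, hw, fun i => ?_⟩
  have h' := h i
  rw [integral_const_mul, integral_finsetSum _ fun x _ => hi _ _ _] at h'
  simp_rw [← hμ.correlationVectorCoeff_eq] at h'
  rw [Finset.sum_const, nsmul_eq_mul, inv_mul_cancel_left₀ hFne] at h'
  exact h'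

end QSubstitution

/-! ### The recursion operator and the limit formula. -/

namespace QSubstitution

variable {d : ℕ} {A : Type*} (S : QSubstitution d A)

theorem tendsto_q_pow (i : Fin d) : Tendsto (fun n => (S.q ^ n) i) atTop atTop :=
  tendsto_pow_atTop_atTop_of_one_lt (S.one_lt_q i)

variable [DecidableEq A] [Fintype A]

/-- The operator `F ↦ (k ↦ Q^{-n} ∑_j (R_j ⊗ R_{j+k}) F(⌊j+k⌋_n))`. -/
noncomputable def correlationOp (n : ℕ) (F : (Fin d → ℤ) → A × A → ℂ) (k : Fin d → ℤ) : A × A → ℂ :=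
  ((S.Q : ℂ) ^ n)⁻¹ • ∑ j ∈ latticeBox (S.q ^ n),
    Matrix.mulVec (S.instructionMatrix n j ⊗ₖ S.instructionMatrix n (j + k))
      (F (latticeQuot (S.q ^ n) (j + k)))

/-- Splitting `j` into its first `p` digits and the rest factors both instruction matrices, and the
mixed product rule factors their Kronecker product. -/
theorem correlationOp_add (p n : ℕ) (F : (Fin d → ℤ) → A × A → ℂ) (k : Fin d → ℤ) :
    S.correlationOp (p + n) F k = S.correlationOp p (S.correlationOp n F) k := by
  unfold correlationOp
  rw [pow_add S.q, sum_latticeBox_mul (S.q_pow_pos p), pow_add, mul_inv, mul_smul, Finset.smul_sum]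
  congr 1
  refine Finset.sum_congr rfl fun i hi => ?_
  rw [Matrix.mulVec_smul, Matrix.mulVec_sum]
  congr 1
  refine Finset.sum_congr rfl fun l _ => ?_
  rw [Matrix.mulVec_mulVec, ← Matrix.mul_kronecker_mul, latticeQuot_mul (S.q_pow_pos p),
    add_right_comm, instructionMatrix_add, instructionMatrix_add, instructionMatrix_add_mul,
    instructionMatrix_add_mul, latticeQuot_add_mul (S.q_pow_pos p),
    latticeQuot_add_mul (S.q_pow_pos p), latticeQuot_of_mem hi, zero_add,
    add_comm (latticeQuot (S.q ^ p) (i + k))]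

theorem kronecker_mulVec_diagonal (n : ℕ) (i j : Fin d → ℤ) (u : A → ℂ) (p : A × A) :
    Matrix.mulVec (S.instructionMatrix n i ⊗ₖ S.instructionMatrix n j)
      (fun r : A × A => if r.1 = r.2 then u r.1 else 0) p =
      ∑ γ, pairInd p (S.genInstruction n i γ) (S.genInstruction n j γ) * u γ := by
  simp only [Matrix.mulVec, dotProduct, Matrix.kroneckerMap_apply, Fintype.sum_prod_type, mul_ite,
    mul_zero, Finset.sum_ite_eq, Finset.mem_univ, if_true]
  refine Finset.sum_congr rfl fun γ _ => ?_
  simp only [instructionMatrix, Matrix.of_apply, pairInd]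
  split_ifs <;> simp_all

theorem correlationOp_diagonal (n : ℕ) (k : Fin d → ℤ) (u : A → ℂ) (p : A × A) :
    S.correlationOp n (fun _ r => if r.1 = r.2 then u r.1 else 0) k p =
      (S.pairFreq n k).mulVec u p := by
  rw [correlationOp, Pi.smul_apply, Finset.sum_apply]
  simp_rw [kronecker_mulVec_diagonal]
  rw [Finset.sum_comm, smul_eq_mul, Finset.mul_sum]
  simp only [Matrix.mulVec, dotProduct, pairFreq, Matrix.of_apply, mul_assoc, Finset.sum_mul]

omit [DecidableEq A] in
theorem norm_mulVec_stdSimplex_le {ι : Type*} (E : Matrix ι A ℂ) {w : A → ℝ}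
    (hw : w ∈ stdSimplex ℝ A) {i : ι} {c : ℝ} (hE : ∀ γ, ‖E i γ‖ ≤ c) :
    ‖∑ γ, E i γ * (w γ : ℂ)‖ ≤ c := by
  calc _ ≤ ∑ γ, c * w γ := by
        refine (norm_sum_le _ _).trans (Finset.sum_le_sum fun γ _ => ?_)
        rw [norm_mul, Complex.norm_real, Real.norm_of_nonneg (hw.1 γ)]
        exact mul_le_mul_of_nonneg_right (hE γ) (hw.1 γ)
    _ = c := by rw [← Finset.mul_sum, hw.2, mul_one]

variable [MeasurableSpace A] [DiscreteMeasurableSpace A] {S} {μ : Measure S.subshift}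
  [IsProbabilityMeasure μ]

/-- Approximation at level `n + m` has an error that vanishes as `m → ∞`; passing back to level `n`
costs only the boundary term on the right. -/
theorem ShiftInvariant.norm_correlationVectorCoeff_sub_le (hμ : S.ShiftInvariant μ) (hd : 1 ≤ d)
    (hindex : S.imprimitivityIndex = 1) (n : ℕ) (k : Fin d → ℤ) (p : A × A) :
    ‖S.correlationVectorCoeff μ k p -
      (S.pairFreq n k).mulVec (fun γ => S.correlationVectorCoeff μ 0 (γ, γ)) p‖ ≤
        1 - overlapFrac (S.q ^ n) k := by
  choose w hw hwε using fun m : ℕ => hμ.exists_stdSimplex_norm_sub_le hd k m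
    (one_div_pos.2 (m.cast_add_one_pos (α := ℝ)))
  have hoverlap : ∀ l : Fin d → ℤ, Tendsto (fun m : ℕ =>
      (1 - overlapFrac (S.q ^ (n + m)) l) + 1 / (((n + m : ℕ) : ℝ) + 1)) atTop (𝓝 0) := by
    intro l
    have h1 := (((tendsto_overlapFrac (S.tendsto_q_pow) l).const_sub 1).add
      (tendsto_one_div_add_atTop_nhds_zero_nat (𝕜 := ℝ))).comp (tendsto_add_atTop_nat n)
    rw [sub_self, add_zero] at h1
    refine h1.congr fun m => ?_
    simp only [Function.comp_apply, add_comm n m]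
  -- the letter frequencies at level `n + m`, propagated `m` times, converge to those of `μ`
  set x : ℕ → A → ℂ := fun m => (S.letterFreq m).mulVec fun γ => (w (n + m) γ : ℂ) with hx
  have hxu : Tendsto x atTop (𝓝 fun γ => S.correlationVectorCoeff μ 0 (γ, γ)) := by
    refine tendsto_pi_nhds.2 fun α => ?_
    have h1 : Tendsto (fun m => (S.letterFreq (n + m)).mulVec (fun γ => (w (n + m) γ : ℂ)) α) atTop
        (𝓝 (S.correlationVectorCoeff μ 0 (α, α))) := by
      rw [tendsto_iff_norm_sub_tendsto_zero]
      refine squeeze_zero (fun _ => norm_nonneg _) (fun m => ?_) (hoverlap 0)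
      have := hwε (n + m) (false, α, α)
      simp only [Bool.false_eq_true, if_false, pairFreq_zero_diag] at this
      rw [norm_sub_rev]
      exact this
    -- Telescoping: `D^m - D^(n+m) = D^m (1 - D) ∑_{i<n} D^i`.
    have h2 : Tendsto (fun m => S.letterFreq m - S.letterFreq (n + m)) atTop (𝓝 0) := by
      have h := (S.tendsto_letterFreq_mul_one_sub hindex).mul_const
        (∑ i ∈ Finset.range n, S.letterFreq 1 ^ i)
      rw [zero_mul] at h
      refine h.congr fun m => ?_
      rw [mul_assoc, mul_neg_geom_sum, mul_sub, mul_one, ← pow_add, ← letterFreq_eq_pow,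
        ← letterFreq_eq_pow, add_comm]
    have h3 : Tendsto (fun m => (S.letterFreq m - S.letterFreq (n + m)).mulVec
        (fun γ => (w (n + m) γ : ℂ)) α) atTop (𝓝 0) := by
      have h4 : Tendsto (fun m => ∑ γ, ‖(S.letterFreq m - S.letterFreq (n + m)) α γ‖) atTop
          (𝓝 0) := by
        simpa using tendsto_finsetSum Finset.univ fun γ _ =>
          (tendsto_pi_nhds.1 (tendsto_pi_nhds.1 h2 α) γ).norm
      refine squeeze_zero_norm (fun m => ?_) h4
      exact norm_mulVec_stdSimplex_le _ (hw _) fun γ =>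
        Finset.single_le_sum (f := fun γ => ‖(S.letterFreq m - S.letterFreq (n + m)) α γ‖)
          (fun _ _ => norm_nonneg _) (Finset.mem_univ γ)
    have h5 := h3.add h1
    rw [zero_add] at h5
    refine h5.congr fun m => ?_
    rw [Matrix.sub_mulVec, Pi.sub_apply, sub_add_cancel]
  have hcont : Tendsto (fun m => ‖S.correlationVectorCoeff μ k p -
      (S.pairFreq n k).mulVec (x m) p‖) atTop (𝓝 ‖S.correlationVectorCoeff μ k p -
      (S.pairFreq n k).mulVec (fun γ => S.correlationVectorCoeff μ 0 (γ, γ)) p‖) := by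
    have hc : Continuous fun y : A → ℂ => ‖S.correlationVectorCoeff μ k p -
        (S.pairFreq n k).mulVec y p‖ := by
      simp only [Matrix.mulVec, dotProduct]
      fun_prop
    exact (hc.tendsto _).comp hxu
  have hbound := (hoverlap k).add_const (1 - overlapFrac (S.q ^ n) k)
  rw [zero_add] at hbound
  -- The bound for each `m` is the triangle inequality through `P_(n+m)(k) w`.
  refine le_of_tendsto_of_tendsto' hcont hbound fun m => ?_
  have h1 := hwε (n + m) (true, p)
  simp only [if_true] at h1
  have h2 : ‖∑ γ, S.pairFreq (n + m) k p γ * (w (n + m) γ : ℂ) -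
      (S.pairFreq n k).mulVec (x m) p‖ ≤ 1 - overlapFrac (S.q ^ n) k := by
    have h3 := norm_mulVec_stdSimplex_le
      (S.pairFreq (n + m) k - S.pairFreq n k * S.letterFreq m) (hw (n + m)) (i := p)
      fun γ => S.norm_pairFreq_sub_le n m k p γ
    refine le_trans (le_of_eq ?_) h3
    rw [hx, Matrix.mulVec_mulVec]
    simp only [Matrix.sub_apply, sub_mul, Finset.sum_sub_distrib]
    rfl
  have h4 := norm_sub_le_norm_sub_add_norm_sub (S.correlationVectorCoeff μ k p)
    (∑ γ, S.pairFreq (n + m) k p γ * (w (n + m) γ : ℂ)) ((S.pairFreq n k).mulVec (x m) p)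
  linarith

omit [Fintype A] in
-- One position cannot carry two different letters.
theorem ShiftInvariant.correlationVectorCoeff_zero (hμ : S.ShiftInvariant μ) :
    S.correlationVectorCoeff μ 0 = fun r : A × A =>
      if r.1 = r.2 then S.correlationVectorCoeff μ 0 (r.1, r.1) else 0 := by
  funext r
  split_ifs with h
  · rw [← Prod.mk.eta (p := r), h]
  · rw [hμ.correlationVectorCoeff_eq 0 0]
    have h0 : ∀ y, pairInd r y y = 0 := fun y => if_neg fun h' => h (h'.1.trans h'.2.symm)
    simp only [add_zero, h0, integral_zero]

theorem ShiftInvariant.tendsto_correlationOp (hμ : S.ShiftInvariant μ) (hd : 1 ≤ d)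
    (hindex : S.imprimitivityIndex = 1) (k : Fin d → ℤ) :
    Tendsto (fun n => S.correlationOp n (fun _ => S.correlationVectorCoeff μ 0) k) atTop
      (𝓝 (S.correlationVectorCoeff μ k)) := by
  refine tendsto_pi_nhds.2 fun p => ?_
  rw [tendsto_iff_norm_sub_tendsto_zero]
  have hlim := (tendsto_overlapFrac S.tendsto_q_pow k).const_sub 1
  rw [sub_self] at hlim
  refine squeeze_zero (fun _ => norm_nonneg _) (fun n => ?_) hlim
  rw [hμ.correlationVectorCoeff_zero,
    S.correlationOp_diagonal n k (fun γ => S.correlationVectorCoeff μ 0 (γ, γ)) p, norm_sub_rev]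
  exact hμ.norm_correlationVectorCoeff_sub_le hd hindex n k p

/-- The limit formula along the levels `p + n` can also be computed by applying the continuous
level-`p` operator to the limit over `n`. -/
theorem ShiftInvariant.correlationVectorCoeff_eq_correlationOp (hμ : S.ShiftInvariant μ)
    (hd : 1 ≤ d) (hindex : S.imprimitivityIndex = 1) (p : ℕ) (k : Fin d → ℤ) :
    S.correlationVectorCoeff μ k = S.correlationOp p (S.correlationVectorCoeff μ) k := by
  have h1 := (hμ.tendsto_correlationOp hd hindex k).comp (tendsto_add_atTop_nat p)
  have h2 : Tendsto (fun n => S.correlationOp p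
      (S.correlationOp n fun _ => S.correlationVectorCoeff μ 0) k) atTop
      (𝓝 (S.correlationOp p (S.correlationVectorCoeff μ) k)) := by
    refine (tendsto_finsetSum _ fun j _ => ?_).const_smul _
    exact ((Continuous.matrix_mulVec continuous_const continuous_id).tendsto _).comp
      (hμ.tendsto_correlationOp hd hindex _)
  refine tendsto_nhds_unique (h1.congr fun n => ?_) h2
  rw [Function.comp_apply, add_comm, correlationOp_add]

end QSubstitution

theorem mainTheorem2 {d : ℕ} (hd : 1 ≤ d) {A : Type*} [Fintype A] [DecidableEq A]
    [MeasurableSpace A] [DiscreteMeasurableSpace A]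
    (S : QSubstitution d A) (hS : S.Aperiodic) (hindex : S.imprimitivityIndex = 1)
    (μ : Measure S.subshift) [IsProbabilityMeasure μ] (hμ : S.ShiftInvariant μ) :
    (∀ α β : A, S.IsSpectralMeasure μ (S.cylinderIndicator α) (S.cylinderIndicator β)
      (S.correlationMeasure μ α β)) ∧
    (∀ (p : ℕ) (k : Fin d → ℤ),
      S.correlationVectorCoeff μ k =
        ((S.Q : ℂ) ^ p)⁻¹ • ∑ j ∈ latticeBox (S.q ^ p),
          Matrix.mulVec (S.instructionMatrix p j ⊗ₖ S.instructionMatrix p (j + k))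
            (S.correlationVectorCoeff μ (latticeQuot (S.q ^ p) (j + k)))) ∧
    (∀ k : Fin d → ℤ,
      Tendsto (fun n : ℕ =>
        ((S.Q : ℂ) ^ n)⁻¹ • ∑ j ∈ latticeBox (S.q ^ n),
          Matrix.mulVec (S.instructionMatrix n j ⊗ₖ S.instructionMatrix n (j + k))
            (S.correlationVectorCoeff μ 0))
        atTop (𝓝 (S.correlationVectorCoeff μ k))) :=
  ⟨hμ.isSpectralMeasure_correlationMeasure, hμ.correlationVectorCoeff_eq_correlationOp hd hindex,
    hμ.tendsto_correlationOp hd hindex⟩
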